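/- Let $(R,\mathfrak m)$ be a Noetherian local ring of dimension $d\ge 1$ with infinite residue field. For an ideal $J$ of $R$ let $\nu(J)$ denote its minimal number of generators, and let $\lambda$ denote length of $R$-modules. Let $I$ be an $\mathfrak m$-primary ideal which is an almost complete intersection, that is, $\nu(I)=\operatorname{height}(I)+1=d+1$. A minimal reduction of $I$ is an ideal $Q=(a_1,\dots,a_d)\subseteq I$ generated by $d$ elements such that $I^{k+1}=QI^k$ for some integer $k\ge 0$; the least such $k$ is denoted $\mathrm r_Q(I)$, and $\mathrm r(I)=\inf\{\mathrm r_Q(I) : Q \text{ is a minimal reduction of } I\}$. Let $Q$ be a minimal reduction of $I$. If $\lambda(I^n/QI^{n-1})=1$ for some integer $n\ge 1$, then $$\mathrm r(I)\le n\,\nu(\mathfrak m)-1 .$$ -/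

import Mathlib

/-- `I` is `𝔪`-primary: its radical is the maximal ideal (which forces `I` to be primary). -/
def IsMPrimary {R : Type*} [CommRing R] [IsLocalRing R] (I : Ideal R) : Prop :=
  I.radical = IsLocalRing.maximalIdeal R

/-- The minimal number of generators of an ideal. -/
noncomputable def idealNu {R : Type*} [CommRing R] (I : Ideal R) : ℕ :=
  Submodule.spanFinrank I

/-- `I` is an almost complete intersection: it is minimally generated by `height I + 1` elements.
For an `𝔪`-primary ideal of a Noetherian local ring, the height is the dimension of the ring. -/
def IsAlmostCompleteIntersection {R : Type*} [CommRing R] (I : Ideal R) : Prop :=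
  (idealNu I : ℕ∞) = I.height + 1

/-- `Q` is a minimal reduction of the (`𝔪`-primary) ideal `I`: `Q ⊆ I` is generated by
`d = dim R` elements and `I ^ (k + 1) = Q * I ^ k` for some `k ≥ 0`. -/
def IsMinimalReduction {R : Type*} [CommRing R] (Q I : Ideal R) : Prop :=
  Q ≤ I ∧
  (∃ d : ℕ, ringKrullDim R = d ∧ ∃ a : Fin d → R, Q = Ideal.span (Set.range a)) ∧
  ∃ k : ℕ, I ^ (k + 1) = Q * I ^ k

/-- The reduction number of `I` relative to `Q`: the least `k ≥ 0` with `I ^ (k + 1) = Q * I ^ k`.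
Such a `k` exists when `Q` is a minimal reduction of `I`. -/
noncomputable def relReductionNumber {R : Type*} [CommRing R] (Q I : Ideal R) : ℕ :=
  sInf {k : ℕ | I ^ (k + 1) = Q * I ^ k}

/-- The reduction number of `I`: the least reduction number of `I` relative to its minimal
reductions. (The infimum is over a nonempty set as soon as `I` has a minimal reduction.) -/
noncomputable def reductionNumber {R : Type*} [CommRing R] (I : Ideal R) : ℕ :=
  sInf {r : ℕ | ∃ Q : Ideal R, IsMinimalReduction Q I ∧ r = relReductionNumber Q I}

/-!
Let `s = ν(𝔪)` and write `I = Q + (x)`. The length hypothesis gives `𝔪Iⁿ ⊆ QIⁿ⁻¹`; distinguish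
whether even `𝔪Iⁿ ⊆ 𝔪QIⁿ⁻¹`.

If not, an element of `𝔪Iⁿ` outside `𝔪QIⁿ⁻¹` is the value of a form of degree `n` in `d + 1`
generators of `I` with a unit coefficient. The residue field being infinite, a linear change of the
generators makes the form monic in one of them modulo `𝔪`, and the other `d` then generate a
reduction `J` with `Iⁿ = JIⁿ⁻¹`.

If so, write `𝔪 = (z₁, …, z_s)` and `xⁿzᵢ = ∑ⱼ bᵢⱼzⱼ` with `bᵢⱼ ∈ QIⁿ⁻¹`, so that the matrix
`A = xⁿ - (bᵢⱼ)` satisfies `Az = 0`. In positive dimension this forces `det A = 0`, not merely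
`(det A)𝔪 = 0`. Expanding the determinant gives `xⁿˢ ∈ QIⁿˢ⁻¹`, hence `Iⁿˢ = QIⁿˢ⁻¹`.

That `det A` vanishes is checked modulo each `𝔪^(N+1)`, where it suffices that `det A` lies in every
nonzero ideal of the artinian quotient. By lifting a Cohen ring, this quotient is an image of
`V[X₁, …, X_s]` with `V` a discrete valuation ring and `Xᵢ ↦ zᵢ`. Adding a high power of `Xᵢ` to
the `i`-th diagonal entry of a lift of `A` does not change its image, but makes the entries of `AX`
a complete intersection, finite free over `V`, whose socle relative to `V` is generated by `det A`.
-/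

/-! ### Complete intersections with pure-power leading forms -/

section LeadingForms

open MvPolynomial

variable {σ V : Type*} [CommRing V] {d e : ℕ} {p q p₀ q₀ : MvPolynomial σ V}

/-- The polynomials of total degree less than `d`. Unlike for `restrictTotalDegree`, the zero
submodule is included, as `d = 0`. -/
noncomputable def degLT (σ V : Type*) [CommRing V] (d : ℕ) : Submodule V (MvPolynomial σ V) :=
  restrictSupport V {m | m.degree < d}

theorem mem_degLT : p ∈ degLT σ V d ↔ ∀ m : σ →₀ ℕ, d ≤ m.degree → coeff m p = 0 := by
  rw [degLT, mem_restrictSupport_iff]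
  refine forall_congr' fun m => ?_
  rw [Finset.mem_coe, mem_support_iff, Set.mem_ofPred_eq, ← not_le, not_imp_not]

theorem degLT_mono (h : d ≤ e) : degLT σ V d ≤ degLT σ V e :=
  restrictSupport_mono V fun _ hm => lt_of_lt_of_le hm h

theorem mem_degLT_of_totalDegree_lt (h : p.totalDegree < d) : p ∈ degLT σ V d :=
  mem_degLT.mpr fun _ hm => coeff_eq_zero_of_totalDegree_lt (h.trans_le hm)

theorem eq_zero_of_mem_degLT_zero (h : p ∈ degLT σ V 0) : p = 0 := by
  ext m
  exact mem_degLT.mp h m (Nat.zero_le _)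

theorem mul_mem_degLT (hp : p ∈ degLT σ V (d + 1)) (hq : q ∈ degLT σ V e) :
    p * q ∈ degLT σ V (d + e) := by
  have h := Submodule.mul_mem_mul hp hq
  rw [degLT, degLT, ← restrictSupport_add] at h
  refine restrictSupport_mono V (Set.add_subset_iff.mpr fun a ha b hb => ?_) h
  simp only [Set.mem_ofPred_eq, map_add] at ha hb ⊢
  lia

theorem mem_degLT_of_isHomogeneous (h : p.IsHomogeneous d) : p ∈ degLT σ V (d + 1) :=
  mem_degLT_of_totalDegree_lt (Nat.lt_succ_of_le h.totalDegree_le)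

/-- `p` has degree at most `d`, and `p₀` (possibly zero) is its homogeneous part of degree `d`. -/
structure HasLeadingForm (p p₀ : MvPolynomial σ V) (d : ℕ) : Prop where
  isHomogeneous : p₀.IsHomogeneous d
  sub_mem : p - p₀ ∈ degLT σ V d

namespace HasLeadingForm

theorem mem_degLT (h : HasLeadingForm p p₀ d) : p ∈ degLT σ V (d + 1) := by
  simpa only [sub_add_cancel] using
    add_mem (degLT_mono d.le_succ h.sub_mem) (mem_degLT_of_isHomogeneous h.isHomogeneous)

theorem of_isHomogeneous (h : p.IsHomogeneous d) : HasLeadingForm p p d :=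
  ⟨h, by simp only [sub_self, zero_mem]⟩

theorem mul (hp : HasLeadingForm p p₀ d) (hq : HasLeadingForm q q₀ e) :
    HasLeadingForm (p * q) (p₀ * q₀) (d + e) where
  isHomogeneous := hp.isHomogeneous.mul hq.isHomogeneous
  sub_mem := by
    have h : p * q - p₀ * q₀ = p * (q - q₀) + q₀ * (p - p₀) := by ring
    rw [h]
    refine add_mem (mul_mem_degLT hp.mem_degLT hq.sub_mem) ?_
    rw [add_comm d e]
    exact mul_mem_degLT (mem_degLT_of_isHomogeneous hq.isHomogeneous) hp.sub_mem

theorem one : HasLeadingForm (1 : MvPolynomial σ V) 1 0 :=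
  of_isHomogeneous (isHomogeneous_one σ V)

theorem X (i : σ) : HasLeadingForm (X i : MvPolynomial σ V) (X i) 1 :=
  of_isHomogeneous (isHomogeneous_X V i)

theorem pow (hp : HasLeadingForm p p₀ d) (n : ℕ) : HasLeadingForm (p ^ n) (p₀ ^ n) (n * d) := by
  induction n with
  | zero => simpa only [pow_zero, zero_mul] using one
  | succ n ih => simpa only [pow_succ, Nat.succ_mul] using ih.mul hp

theorem prod {ι : Type*} {s : Finset ι} {f f₀ : ι → MvPolynomial σ V} {d : ι → ℕ}
    (h : ∀ i ∈ s, HasLeadingForm (f i) (f₀ i) (d i)) :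
    HasLeadingForm (∏ i ∈ s, f i) (∏ i ∈ s, f₀ i) (∑ i ∈ s, d i) := by
  classical
  induction s using Finset.induction_on with
  | empty => exact one
  | insert a s ha ih =>
    rw [Finset.prod_insert ha, Finset.prod_insert ha, Finset.sum_insert ha]
    exact (h a (Finset.mem_insert_self _ _)).mul
      (ih fun i hi => h i (Finset.mem_insert_of_mem hi))

theorem sum {ι : Type*} {s : Finset ι} {f f₀ : ι → MvPolynomial σ V}
    (h : ∀ i ∈ s, HasLeadingForm (f i) (f₀ i) d) :
    HasLeadingForm (∑ i ∈ s, f i) (∑ i ∈ s, f₀ i) d where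
  isHomogeneous := IsHomogeneous.sum _ _ _ fun i hi => (h i hi).isHomogeneous
  sub_mem := by
    rw [← Finset.sum_sub_distrib]
    exact sum_mem fun i hi => (h i hi).sub_mem

theorem C_mul (hp : HasLeadingForm p p₀ d) (c : V) : HasLeadingForm (C c * p) (C c * p₀) d := by
  simpa only [zero_add] using (of_isHomogeneous (isHomogeneous_C σ c)).mul hp

theorem map {W : Type*} [CommRing W] (φ : V →+* W) (hp : HasLeadingForm p p₀ d) :
    HasLeadingForm (p.map φ) (p₀.map φ) d where
  isHomogeneous := hp.isHomogeneous.map φ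
  sub_mem := _root_.mem_degLT.mpr fun m hm => by
    rw [← map_sub, coeff_map, _root_.mem_degLT.mp hp.sub_mem m hm, map_zero]

end HasLeadingForm

end LeadingForms

section StandardMonomials

open MvPolynomial

variable {σ V : Type*} [CommRing V] [Fintype σ] {f : σ → MvPolynomial σ V} {M d : ℕ}

/-- The product `∏ fᵢ ^ (βᵢ / M) * Xᵢ ^ (βᵢ % M)`. When `fᵢ` has leading form `Xᵢ ^ M`, it has
leading form `X ^ β`, and it lies in the ideal `(f)` unless all `βᵢ` are less than `M`. -/
noncomputable def standardProd (f : σ → MvPolynomial σ V) (M : ℕ) (β : σ →₀ ℕ) :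
    MvPolynomial σ V :=
  ∏ i, f i ^ (β i / M) * X i ^ (β i % M)

theorem hasLeadingForm_standardProd (hf : ∀ i, HasLeadingForm (f i) (X i ^ M) M) (β : σ →₀ ℕ) :
    HasLeadingForm (standardProd f M β) (monomial β 1) β.degree := by
  have h := HasLeadingForm.prod (s := Finset.univ)
    fun i _ => ((hf i).pow (β i / M)).mul ((HasLeadingForm.X i).pow (β i % M))
  simp only [← pow_mul, ← pow_add, Nat.div_add_mod, mul_one, Nat.div_add_mod'] at h
  rwa [← Finsupp.degree_eq_sum, ← Finsupp.prod_fintype β _ fun i => pow_zero (X i),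
    ← one_mul (β.prod _), ← C_1, ← monomial_eq] at h

theorem standardProd_add_single (hM : 0 < M) (β : σ →₀ ℕ) (i : σ) :
    standardProd f M (β + Finsupp.single i M) = f i * standardProd f M β := by
  classical
  unfold standardProd
  rw [← Finset.mul_prod_erase _ _ (Finset.mem_univ i),
    ← Finset.mul_prod_erase Finset.univ (fun j => f j ^ (β j / M) * X j ^ (β j % M))
      (Finset.mem_univ i), ← mul_assoc]
  congr 1
  · simp only [Finsupp.add_apply, Finsupp.single_eq_same, Nat.add_mod_right,
      Nat.add_div_right _ hM, pow_succ]
    ring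
  · refine Finset.prod_congr rfl fun j hj => ?_
    rw [Finsupp.add_apply, Finsupp.single_eq_of_ne (Finset.ne_of_mem_erase hj), add_zero]

/-- The exponents all of whose entries are less than `M`. The corresponding monomials form a basis
modulo the ideal `(f)`. -/
def standardExponents (σ : Type*) (M : ℕ) : Set (σ →₀ ℕ) :=
  {γ | ∀ i, γ i < M}

theorem standardProd_of_mem {β : σ →₀ ℕ} (h : β ∈ standardExponents σ M) :
    standardProd f M β = monomial β 1 := by
  rw [standardProd, monomial_eq, Finsupp.prod_fintype _ _ fun i => pow_zero (X i), C_1, one_mul]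
  refine Finset.prod_congr rfl fun i _ => ?_
  rw [Nat.div_eq_of_lt (h i), Nat.mod_eq_of_lt (h i), pow_zero, one_mul]

theorem standardProd_mem_span (hM : 0 < M) {β : σ →₀ ℕ} (h : β ∉ standardExponents σ M) :
    standardProd f M β ∈ Ideal.span (Set.range f) := by
  obtain ⟨i, hi⟩ : ∃ i, M ≤ β i := by simpa [standardExponents] using h
  rw [← tsub_add_cancel_of_le (Finsupp.single_le_iff.mpr hi), standardProd_add_single hM]
  exact Ideal.mul_mem_right _ _ (Ideal.subset_span ⟨i, rfl⟩)

/-- The linear endomorphism sending the monomial `X ^ β` to `standardProd f M β`. -/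
noncomputable def standardMap (f : σ → MvPolynomial σ V) (M : ℕ) :
    MvPolynomial σ V →ₗ[V] MvPolynomial σ V :=
  (basisMonomials σ V).constr V (standardProd f M)

theorem standardMap_monomial (β : σ →₀ ℕ) (a : V) :
    standardMap f M (monomial β a) = a • standardProd f M β := by
  have h : standardMap f M (basisMonomials σ V β) = standardProd f M β :=
    (basisMonomials σ V).constr_basis V _ β
  rw [← h, ← map_smul, coe_basisMonomials, smul_monomial, smul_eq_mul, mul_one]

theorem standardMap_apply (p : MvPolynomial σ V) :
    standardMap f M p = ∑ m ∈ p.support, coeff m p • standardProd f M m := by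
  conv_lhs => rw [p.as_sum]
  simp only [map_sum, standardMap_monomial]

theorem standardMap_sub_mem (hf : ∀ i, HasLeadingForm (f i) (X i ^ M) M)
    {p : MvPolynomial σ V} (hp : p ∈ degLT σ V (d + 1)) :
    standardMap f M p - p ∈ degLT σ V d := by
  have h : standardMap f M p - p =
      ∑ m ∈ p.support, coeff m p • (standardProd f M m - monomial m 1) := by
    simp only [standardMap_apply, smul_sub, Finset.sum_sub_distrib, smul_monomial, smul_eq_mul,
      mul_one, ← p.as_sum]
  rw [h]
  refine sum_mem fun m hm => Submodule.smul_mem _ _ ?_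
  refine degLT_mono ?_ (hasLeadingForm_standardProd hf m).sub_mem
  by_contra hmd
  exact mem_support_iff.mp hm (mem_degLT.mp hp m (by lia))

theorem mem_degLT_of_standardMap (hf : ∀ i, HasLeadingForm (f i) (X i ^ M) M)
    {p : MvPolynomial σ V} (hp : standardMap f M p ∈ degLT σ V d) : p ∈ degLT σ V d := by
  suffices h : ∀ e, p ∈ degLT σ V e → p ∈ degLT σ V d from
    h _ (mem_degLT_of_totalDegree_lt p.totalDegree.lt_succ_self)
  intro e he
  induction e with
  | zero => exact degLT_mono d.zero_le he
  | succ e ih =>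
    by_cases hde : e + 1 ≤ d
    · exact degLT_mono hde he
    · refine ih ?_
      simpa only [sub_sub_cancel] using
        sub_mem (degLT_mono (by lia) hp) (standardMap_sub_mem hf he)

theorem standardMap_bijective (hf : ∀ i, HasLeadingForm (f i) (X i ^ M) M) :
    Function.Bijective (standardMap f M) := by
  constructor
  · rw [← LinearMap.ker_eq_bot, LinearMap.ker_eq_bot']
    intro p hp
    exact eq_zero_of_mem_degLT_zero (mem_degLT_of_standardMap hf (hp ▸ zero_mem _))
  · suffices h : ∀ d, ∀ q ∈ degLT σ V d, ∃ p, standardMap f M p = q from fun q =>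
      h _ q (mem_degLT_of_totalDegree_lt q.totalDegree.lt_succ_self)
    intro d
    induction d with
    | zero => exact fun q hq => ⟨0, by rw [eq_zero_of_mem_degLT_zero hq, map_zero]⟩
    | succ d ih =>
      intro q hq
      obtain ⟨r, hr⟩ := ih _ (standardMap_sub_mem hf hq)
      exact ⟨q - r, by rw [map_sub, hr, sub_sub_cancel]⟩

/-- `standardMap` as a linear automorphism. The coefficients of `(standardEquiv hf).symm t` are the
coordinates of `t` in the basis of standard products. -/
noncomputable def standardEquiv (hf : ∀ i, HasLeadingForm (f i) (X i ^ M) M) :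
    MvPolynomial σ V ≃ₗ[V] MvPolynomial σ V :=
  LinearEquiv.ofBijective _ (standardMap_bijective hf)

theorem standardMap_symm (hf : ∀ i, HasLeadingForm (f i) (X i ^ M) M) (t : MvPolynomial σ V) :
    standardMap f M ((standardEquiv hf).symm t) = t :=
  (standardEquiv hf).apply_symm_apply t

theorem symm_standardMap (hf : ∀ i, HasLeadingForm (f i) (X i ^ M) M) (p : MvPolynomial σ V) :
    (standardEquiv hf).symm (standardMap f M p) = p :=
  (standardEquiv hf).symm_apply_apply p

theorem standardEquiv_symm_sub_mem (hf : ∀ i, HasLeadingForm (f i) (X i ^ M) M)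
    {t : MvPolynomial σ V} (ht : t ∈ degLT σ V (d + 1)) :
    (standardEquiv hf).symm t - t ∈ degLT σ V d := by
  have h : (standardEquiv hf).symm t ∈ degLT σ V (d + 1) :=
    mem_degLT_of_standardMap hf (by rwa [standardMap_symm])
  simpa only [standardMap_symm, neg_sub] using neg_mem (standardMap_sub_mem hf h)

theorem standardMap_X_pow_mul (hM : 0 < M) (i : σ) (p : MvPolynomial σ V) :
    standardMap f M (X i ^ M * p) = f i * standardMap f M p := by
  induction p using MvPolynomial.induction_on' with
  | monomial u a =>
    rw [X_pow_eq_monomial, monomial_mul, one_mul, standardMap_monomial, standardMap_monomial,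
      add_comm, standardProd_add_single hM, mul_smul_comm]
  | add p q hp hq => rw [mul_add, map_add, map_add, mul_add, hp, hq]

theorem standardEquiv_symm_mul (hf : ∀ i, HasLeadingForm (f i) (X i ^ M) M) (hM : 0 < M) (i : σ)
    (t : MvPolynomial σ V) :
    (standardEquiv hf).symm (f i * t) = X i ^ M * (standardEquiv hf).symm t := by
  conv_lhs => rw [← standardMap_symm hf t, ← standardMap_X_pow_mul hM, symm_standardMap]

theorem mem_span_range_iff_coeff_eq_zero (hf : ∀ i, HasLeadingForm (f i) (X i ^ M) M)
    (hM : 0 < M) {t : MvPolynomial σ V} :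
    t ∈ Ideal.span (Set.range f) ↔
      ∀ γ ∈ standardExponents σ M, coeff γ ((standardEquiv hf).symm t) = 0 := by
  constructor
  · intro ht γ hγ
    obtain ⟨c, rfl⟩ := Ideal.mem_span_range_iff_exists_fun.mp ht
    rw [map_sum, coeff_sum]
    refine Finset.sum_eq_zero fun i _ => ?_
    rw [mul_comm, standardEquiv_symm_mul hf hM, X_pow_eq_monomial, coeff_monomial_mul', if_neg]
    exact fun h => (hγ i).not_ge (Finsupp.single_le_iff.mp h)
  · intro h
    rw [← standardMap_symm hf t, standardMap_apply]
    refine sum_mem fun m hm => Submodule.smul_of_tower_mem _ _ ?_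
    exact standardProd_mem_span hM fun hmM => mem_support_iff.mp hm (h m hmM)

theorem standardMap_eq_self {r : MvPolynomial σ V}
    (hr : r ∈ restrictSupport V (standardExponents σ M)) : standardMap f M r = r := by
  rw [standardMap_apply]
  conv_rhs => rw [r.as_sum]
  refine Finset.sum_congr rfl fun m hm => ?_
  rw [standardProd_of_mem (hr hm), smul_monomial, smul_eq_mul, mul_one]

end StandardMonomials

section Quotient

open MvPolynomial

variable {σ V : Type*} [CommRing V] [Finite σ] {f : σ → MvPolynomial σ V} {M : ℕ}

theorem exists_mem_restrictSupport_sub_mem (hf : ∀ i, HasLeadingForm (f i) (X i ^ M) M)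
    (hM : 0 < M) (t : MvPolynomial σ V) :
    ∃ r ∈ restrictSupport V (standardExponents σ M), t - r ∈ Ideal.span (Set.range f) := by
  cases nonempty_fintype σ
  suffices h : t ∈ restrictSupport V (standardExponents σ M) ⊔
      (Ideal.span (Set.range f)).restrictScalars V by
    obtain ⟨r, hr, s, hs, rfl⟩ := Submodule.mem_sup.mp h
    exact ⟨r, hr, by rwa [add_sub_cancel_left]⟩
  rw [← standardMap_symm hf t, standardMap_apply]
  refine sum_mem fun m _ => Submodule.smul_mem _ _ ?_
  by_cases hm : m ∈ standardExponents σ M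
  · rw [standardProd_of_mem hm]
    exact Submodule.mem_sup_left ((monomial_mem_restrictSupport _).mpr (Or.inl hm))
  · exact Submodule.mem_sup_right (standardProd_mem_span hM hm)

theorem mem_span_range_of_C_mul_mem (hf : ∀ i, HasLeadingForm (f i) (X i ^ M) M) (hM : 0 < M)
    {a : V} (ha : a ∈ nonZeroDivisors V) {t : MvPolynomial σ V}
    (h : C a * t ∈ Ideal.span (Set.range f)) : t ∈ Ideal.span (Set.range f) := by
  cases nonempty_fintype σ
  rw [mem_span_range_iff_coeff_eq_zero hf hM] at h ⊢
  intro γ hγ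
  have hγ0 := h γ hγ
  rw [← smul_eq_C_mul, map_smul, coeff_smul, smul_eq_mul] at hγ0
  exact (mem_nonZeroDivisors_iff.mp ha).1 _ hγ0

theorem finite_quotient_span_range (hf : ∀ i, HasLeadingForm (f i) (X i ^ M) M) (hM : 0 < M) :
    Module.Finite V (MvPolynomial σ V ⧸ Ideal.span (Set.range f)) := by
  classical
  have hfin : (standardExponents σ M).Finite :=
    (Set.finite_Icc 0 (Finsupp.equivFunOnFinite.symm fun _ => M)).subset fun γ hγ =>
      ⟨zero_le, fun i => (hγ i).le⟩
  have : Module.Finite V (restrictSupport V (standardExponents σ M)) := by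
    rw [Module.Finite.iff_fg, restrictSupport_eq_span]
    exact Submodule.fg_span (hfin.image _)
  refine Module.Finite.of_surjective ((Ideal.Quotient.mkₐ V (Ideal.span (Set.range f))).toLinearMap
    ∘ₗ (restrictSupport V (standardExponents σ M)).subtype) fun x => ?_
  obtain ⟨t, rfl⟩ := Ideal.Quotient.mk_surjective x
  obtain ⟨r, hr, htr⟩ := exists_mem_restrictSupport_sub_mem hf hM t
  exact ⟨⟨r, hr⟩, (Ideal.Quotient.eq.mpr htr).symm⟩

end Quotient

section Socle

open MvPolynomial

variable {σ V : Type*} [CommRing V] [Finite σ]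

theorem coeff_eq_zero_of_X_mul_mem {f : σ → MvPolynomial σ V} {N : ℕ}
    (hf : ∀ i, HasLeadingForm (f i) (X i ^ (N + 1)) (N + 1)) {r : MvPolynomial σ V} {γ : σ →₀ ℕ}
    (hγ : γ ∈ standardExponents σ (N + 1)) (hr : r ∈ degLT σ V (γ.degree + 1)) {j : σ}
    (hj : γ j < N) (hX : X j * r ∈ Ideal.span (Set.range f)) : coeff γ r = 0 := by
  classical
  cases nonempty_fintype σ
  have hdeg : X j * r ∈ degLT σ V (γ.degree + 1 + 1) := by
    rw [add_comm _ 1]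
    exact mul_mem_degLT (HasLeadingForm.X j).mem_degLT hr
  have hlow := mem_degLT.mp (standardEquiv_symm_sub_mem hf hdeg) (γ + Finsupp.single j 1)
    (by rw [map_add, Finsupp.degree_single])
  have hstd : γ + Finsupp.single j 1 ∈ standardExponents σ (N + 1) := fun i => by
    have hi := hγ i
    rw [Finsupp.add_apply, Finsupp.single_apply]
    split_ifs with hij
    · subst hij; lia
    · lia
  rwa [coeff_sub, (mem_span_range_iff_coeff_eq_zero hf N.succ_pos).mp hX _ hstd, zero_sub,
    neg_eq_zero, add_comm γ, coeff_X_mul] at hlow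

/-- The largest standard exponent `(N, …, N)` for `M = N + 1`. -/
noncomputable def topExponent (σ : Type*) [Finite σ] (N : ℕ) : σ →₀ ℕ :=
  Finsupp.equivFunOnFinite.symm fun _ => N

theorem topExponent_mem (N : ℕ) : topExponent σ N ∈ standardExponents σ (N + 1) :=
  fun _ => N.lt_succ_self

theorem eq_zero_of_forall_X_mul_mem {f : σ → MvPolynomial σ V} {N : ℕ}
    (hf : ∀ i, HasLeadingForm (f i) (X i ^ (N + 1)) (N + 1)) {r : MvPolynomial σ V}
    (hr : r ∈ restrictSupport V (standardExponents σ (N + 1)))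
    (hX : ∀ j, X j * r ∈ Ideal.span (Set.range f)) (htop : coeff (topExponent σ N) r = 0) :
    r = 0 := by
  by_contra hr0
  obtain ⟨γ, hγ, hmax⟩ := r.support.exists_max_image (fun m => m.degree) (support_nonempty.mpr hr0)
  have hdeg : r ∈ degLT σ V (γ.degree + 1) := mem_degLT.mpr fun m hm => by
    by_contra hmr
    exact (hmax m (mem_support_iff.mpr hmr)).not_gt hm
  obtain ⟨j, hj⟩ : ∃ j, γ j < N := by
    by_contra! hN
    have hγN : γ = topExponent σ N := Finsupp.ext fun i =>
      le_antisymm (Nat.lt_succ_iff.mp (hr hγ i)) (hN i)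
    exact mem_support_iff.mp hγ (hγN ▸ htop)
  exact mem_support_iff.mp hγ (coeff_eq_zero_of_X_mul_mem hf (hr hγ) hdeg hj (hX j))

end Socle

section DiagonalLeadingForm

open MvPolynomial

variable {σ V : Type*} [CommRing V] [DecidableEq σ] {A : Matrix σ σ (MvPolynomial σ V)} {N : ℕ}

/-- The diagonal entries `A i i` have leading form `X i ^ N`, and the other entries have degree less
than `N`. -/
def HasDiagonalLeadingForm (A : Matrix σ σ (MvPolynomial σ V)) (N : ℕ) : Prop :=
  ∀ i j, HasLeadingForm (A i j) (Matrix.diagonal (fun i => X i ^ N) i j) N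

theorem HasDiagonalLeadingForm.map {W : Type*} [CommRing W] (φ : V →+* W)
    (hA : HasDiagonalLeadingForm A N) :
    HasDiagonalLeadingForm (A.map (MvPolynomial.map φ)) N := fun i j => by
  have h := (hA i j).map φ
  rw [Matrix.diagonal_apply] at h ⊢
  split_ifs with hij <;> simpa [hij] using h

variable [Fintype σ]

theorem HasDiagonalLeadingForm.mulVec_X (hA : HasDiagonalLeadingForm A N) (i : σ) :
    HasLeadingForm (A.mulVec X i) (X i ^ (N + 1)) (N + 1) := by
  have h : (Matrix.diagonal fun i => X i ^ N).mulVec X i =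
      (X i ^ (N + 1) : MvPolynomial σ V) := by
    rw [Matrix.mulVec_diagonal, pow_succ]
  rw [← h]
  exact HasLeadingForm.sum fun j _ => (hA i j).mul (HasLeadingForm.X j)

theorem HasDiagonalLeadingForm.det (hA : HasDiagonalLeadingForm A N) :
    HasLeadingForm A.det (monomial (topExponent σ N) 1) (topExponent σ N).degree := by
  have hdeg : (topExponent σ N).degree = ∑ _i : σ, N := Finsupp.degree_eq_sum _
  have hdet : (monomial (topExponent σ N) 1 : MvPolynomial σ V) =
      (Matrix.diagonal fun i => X i ^ N).det := by
    rw [Matrix.det_diagonal, monomial_eq, Finsupp.prod_fintype _ _ fun i => pow_zero (X i), C_1,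
      one_mul]
    rfl
  rw [hdeg, hdet, Matrix.det_apply', Matrix.det_apply']
  refine HasLeadingForm.sum fun π _ => ?_
  simpa only [map_intCast] using
    (HasLeadingForm.prod fun i _ => hA (π i) i).C_mul (((Equiv.Perm.sign π : ℤˣ) : ℤ) : V)

theorem X_mul_det_mem_span (A : Matrix σ σ (MvPolynomial σ V)) (j : σ) :
    X j * A.det ∈ Ideal.span (Set.range (A.mulVec X)) := by
  have h : A.adjugate.mulVec (A.mulVec X) j = X j * A.det := by
    rw [Matrix.mulVec_mulVec, Matrix.adjugate_mul, Matrix.smul_mulVec, Matrix.one_mulVec,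
      Pi.smul_apply, smul_eq_mul, mul_comm]
  rw [← h, Matrix.mulVec, dotProduct]
  exact sum_mem fun i _ => Ideal.mul_mem_left _ _ (Ideal.subset_span ⟨i, rfl⟩)

theorem HasDiagonalLeadingForm.exists_remainder_det (hA : HasDiagonalLeadingForm A N) :
    ∃ r ∈ restrictSupport V (standardExponents σ (N + 1)),
      A.det - r ∈ Ideal.span (Set.range (A.mulVec X)) ∧ coeff (topExponent σ N) r = 1 := by
  obtain ⟨r, hr, hdr⟩ := exists_mem_restrictSupport_sub_mem hA.mulVec_X N.succ_pos A.det
  refine ⟨r, hr, hdr, ?_⟩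
  have hcoeff := (mem_span_range_iff_coeff_eq_zero hA.mulVec_X N.succ_pos).mp hdr _
    (topExponent_mem N)
  have hsymm : (standardEquiv hA.mulVec_X).symm r = r := by
    conv_lhs => rw [← standardMap_eq_self hr, symm_standardMap]
  have hlow := mem_degLT.mp (standardEquiv_symm_sub_mem hA.mulVec_X hA.det.mem_degLT) _ le_rfl
  have hlead := mem_degLT.mp hA.det.sub_mem _ le_rfl
  rw [map_sub, hsymm, coeff_sub, sub_eq_zero] at hcoeff
  rw [coeff_sub, sub_eq_zero] at hlow hlead
  rw [← hcoeff, hlow, hlead, coeff_monomial, if_pos rfl]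

theorem HasDiagonalLeadingForm.exists_sub_C_mul_det_mem (hA : HasDiagonalLeadingForm A N)
    {t : MvPolynomial σ V} (ht : ∀ j, X j * t ∈ Ideal.span (Set.range (A.mulVec X))) :
    ∃ v : V, t - C v * A.det ∈ Ideal.span (Set.range (A.mulVec X)) := by
  obtain ⟨r, hr, htr⟩ := exists_mem_restrictSupport_sub_mem hA.mulVec_X N.succ_pos t
  obtain ⟨δ, hδ, hdδ, htop⟩ := hA.exists_remainder_det
  set v := coeff (topExponent σ N) r
  have hmem : t - C v * A.det - (r - v • δ) ∈ Ideal.span (Set.range (A.mulVec X)) := by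
    have h := sub_mem htr (Ideal.mul_mem_left _ (C v) hdδ)
    rw [smul_eq_C_mul]
    convert h using 1
    ring
  have h0 : r - v • δ = 0 := by
    refine eq_zero_of_forall_X_mul_mem hA.mulVec_X
      (sub_mem hr (Submodule.smul_mem _ _ hδ)) (fun j => ?_) ?_
    · have h := sub_mem (sub_mem (ht j) (Ideal.mul_mem_left _ (C v) (X_mul_det_mem_span A j)))
        (Ideal.mul_mem_left _ (X j) hmem)
      convert h using 1
      ring
    · rw [coeff_sub, coeff_smul, htop, smul_eq_mul, mul_one, sub_self]
  exact ⟨v, by rwa [h0, sub_zero] at hmem⟩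

theorem HasDiagonalLeadingForm.exists_sub_C_mul_det_mem_sup (hA : HasDiagonalLeadingForm A N)
    (I : Ideal V) {t : MvPolynomial σ V}
    (ht : ∀ j, X j * t ∈ Ideal.span (Set.range (A.mulVec X)) ⊔ I.map C) :
    ∃ v : V, t - C v * A.det ∈ Ideal.span (Set.range (A.mulVec X)) ⊔ I.map C := by
  let q : MvPolynomial σ V →+* MvPolynomial σ (V ⧸ I) := MvPolynomial.map (Ideal.Quotient.mk I)
  have hq : Function.Surjective q := map_surjective _ Ideal.Quotient.mk_surjective
  have hqX : q ∘ X = X := funext fun i => map_X _ i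
  have hmem : ∀ u, u ∈ Ideal.span (Set.range (A.mulVec X)) ⊔ I.map C ↔
      q u ∈ Ideal.span (Set.range ((A.map q).mulVec X)) := fun u => by
    have hspan : Ideal.span (Set.range ((A.map q).mulVec X)) =
        (Ideal.span (Set.range (A.mulVec X))).map q := by
      rw [Ideal.map_span, ← Set.range_comp]
      congr 2
      ext1 i
      rw [Function.comp_apply, RingHom.map_mulVec, hqX]
    rw [hspan, ← Ideal.mem_comap, Ideal.comap_map_of_surjective' _ hq, ker_map, Ideal.mk_ker]
  obtain ⟨v, hv⟩ := (hA.map (Ideal.Quotient.mk I)).exists_sub_C_mul_det_mem (t := q t) fun j => by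
    simpa only [map_mul, q, map_X] using (hmem _).mp (ht j)
  obtain ⟨v, rfl⟩ := Ideal.Quotient.mk_surjective v
  refine ⟨v, (hmem _).mpr ?_⟩
  rw [map_sub, map_mul, RingHom.map_det]
  simpa only [q, map_C, RingHom.mapMatrix_apply] using hv

end DiagonalLeadingForm

/-! ### Relative socles over a discrete valuation ring -/

section RelativeSocle

variable {ι V S : Type*} [CommRing V] [CommRing S] [Algebra V S] {x : ι → S} {δ : S}

/-- The element `δ` generates the socle of `S` relative to `x`, as a `V`-module and universally in
`V`: it is annihilated by all `x j`, and for every `τ : V` each element of `S ⧸ (τ)` annihilated by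
all `x j` is a `V`-multiple of `δ`. -/
structure IsRelativeSocleGenerator (V : Type*) {ι S : Type*} [CommRing V] [CommRing S] [Algebra V S]
    (x : ι → S) (δ : S) : Prop where
  mul_eq_zero : ∀ j, x j * δ = 0
  exists_dvd_sub_smul : ∀ (τ : V) (t : S), (∀ j, algebraMap V S τ ∣ x j * t) →
    ∃ v : V, algebraMap V S τ ∣ t - v • δ

variable [Fintype ι]

theorem IsRelativeSocleGenerator.dotProduct_mul_eq_zero (hδ : IsRelativeSocleGenerator V x δ)
    (p : ι → S) : (p ⬝ᵥ x) * δ = 0 := by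
  rw [dotProduct, Finset.sum_mul]
  exact Finset.sum_eq_zero fun i _ => by rw [mul_assoc, hδ.mul_eq_zero, mul_zero]

/-- If `x j * t = (τ - y) * u j` with `y = ∑ i, p i * x i`, regularity of `τ - y` gives
`x j * u i = x i * u j`, so that `t + ∑ i, p i * u i` is annihilated by all `x j` modulo `τ`. -/
theorem IsRelativeSocleGenerator.exists_sub_dvd_sub_smul (hδ : IsRelativeSocleGenerator V x δ)
    {τ : V} (hτ : algebraMap V S τ ∈ nonZeroDivisors S) {p : ι → S}
    (hreg : algebraMap V S τ - p ⬝ᵥ x ∈ nonZeroDivisors S) {t : S}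
    (ht : ∀ j, algebraMap V S τ - p ⬝ᵥ x ∣ x j * t) :
    ∃ v : V, algebraMap V S τ - p ⬝ᵥ x ∣ t - v • δ := by
  choose u hu using ht
  have hxu : ∀ i j, x j * u i = x i * u j := fun i j =>
    (mul_cancel_left_mem_nonZeroDivisors hreg).mp <| by
      linear_combination x i * hu j - x j * hu i
  have hmul : ∀ j, x j * (t + p ⬝ᵥ u) = algebraMap V S τ * u j := fun j => by
    have h : x j * p ⬝ᵥ u = p ⬝ᵥ x * u j := by
      simp only [dotProduct, Finset.mul_sum, Finset.sum_mul]
      exact Finset.sum_congr rfl fun i _ => by linear_combination p i * hxu i j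
    linear_combination hu j + h
  obtain ⟨v, w, hw⟩ := hδ.exists_dvd_sub_smul τ _ fun j => Dvd.intro _ (hmul j).symm
  have hxw : ∀ j, u j = x j * w := fun j =>
    (mul_cancel_left_mem_nonZeroDivisors hτ).mp <| by
      have h0 := hδ.mul_eq_zero j
      rw [Algebra.smul_def] at hw
      linear_combination x j * hw - hmul j + algebraMap V S v * h0
  have hpu : p ⬝ᵥ u = p ⬝ᵥ x * w := by
    simp only [dotProduct, hxw, Finset.sum_mul, mul_assoc]
  exact ⟨v, w, by linear_combination hw - hpu⟩

end RelativeSocle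

section Perturbation

open IsLocalRing

variable {V : Type*} [CommRing V] [IsDomain V] [IsLocalRing V]

theorem exists_irreducible_dvd_sub_eval_ne_zero {π : V} (hπ : Irreducible π) (K : ℕ)
    {χ : Polynomial V} (hχ : χ ≠ 0) :
    ∃ τ, Irreducible τ ∧ π ^ K ∣ τ - π ∧ χ.eval τ ≠ 0 := by
  by_contra! h
  have hinj : Function.Injective fun k : ℕ => π + π ^ (K + 2 + k) := fun k l hkl => by
    have hkl := pow_injective_of_not_isUnit hπ.not_isUnit hπ.ne_zero (add_left_cancel hkl)
    lia
  refine hχ (Polynomial.eq_zero_of_infinite_isRoot χ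
    ((Set.infinite_range_of_injective hinj).mono ?_))
  rintro _ ⟨k, rfl⟩
  refine h _ ?_ ⟨π ^ (2 + k), by ring⟩
  have hunit : IsUnit (1 + π ^ (K + 1 + k)) := by
    have hmem : -π ^ (K + 1 + k) ∈ nonunits V :=
      (mem_maximalIdeal _).mp (neg_mem (Ideal.pow_mem_of_mem _
        ((mem_maximalIdeal _).mpr hπ.not_isUnit) _ (by lia)))
    simpa only [sub_neg_eq_add] using isUnit_one_sub_self_of_mem_nonunits _ hmem
  have hfactor : π + π ^ (K + 2 + k) = π * (1 + π ^ (K + 1 + k)) := by ring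
  simpa only [hfactor] using (irreducible_mul_isUnit hunit).mpr hπ

end Perturbation

section ZeroDimensional

theorem exists_forall_mul_mul_eq_zero_iff {T : Type*} [CommRing T] [IsNoetherianRing T]
    [Ring.KrullDimLE 0 T] {P : Ideal T} [P.IsPrime] {x : T} (hx : ∀ u, u * x = 0 → u ∈ P) :
    ∃ h, ∀ u, u * (h * x) = 0 ↔ u ∈ P := by
  have hann : Module.annihilator T (Ideal.span {x}) ≤ P := fun u hu =>
    hx u (congrArg Subtype.val (Module.mem_annihilator.mp hu ⟨x, Ideal.mem_span_singleton_self x⟩))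
  have hmin : P ∈ (Module.annihilator T (Ideal.span {x})).minimalPrimes :=
    ⟨⟨‹_›, hann⟩, fun q hq hqP =>
      have := hq.1
      (q.isMaximal_of_isPrime.eq_of_le ‹P.IsPrime›.ne_top hqP).ge⟩
  obtain ⟨-, ⟨q, hq⟩, rfl⟩ := isAssociatedPrime_iff.mp
    (Module.associatedPrimes.minimalPrimes_annihilator_subset_associatedPrimes T _ hmin)
  obtain ⟨h, rfl⟩ := Ideal.mem_span_singleton'.mp hq
  refine ⟨h, fun u => ?_⟩
  rw [Submodule.mem_colon_singleton, Submodule.mem_bot, Subtype.ext_iff]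
  rfl

theorem krullDimLE_zero_of_algebraMap_eq_zero {V S : Type*} [CommRing V] [Ring.DimensionLEOne V]
    [CommRing S] [Algebra V S] [Algebra.IsIntegral V S] {c : V} (hc : c ≠ 0)
    (hcS : algebraMap V S c = 0) : Ring.KrullDimLE 0 S := by
  refine Ring.krullDimLE_zero_iff.mpr fun P hP => ?_
  refine Ideal.isMaximal_of_isIntegral_of_isMaximal_comap (R := V) P ?_
  refine Ring.DimensionLEOne.maximalOfPrime (fun h => hc ?_) (Ideal.comap_isPrime _ P)
  rw [← Ideal.mem_bot, ← h, Ideal.mem_comap, hcS]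
  exact zero_mem _

theorem sub_dvd_algebraMap_eval {V S : Type*} [CommRing V] [CommRing S] [Algebra V S]
    {χ : Polynomial V} {y : S} (hχ : Polynomial.aeval y χ = 0) (τ : V) :
    algebraMap V S τ - y ∣ algebraMap V S (χ.eval τ) := by
  have h := Polynomial.sub_dvd_eval_sub (algebraMap V S τ) y (χ.map (algebraMap V S))
  rwa [Polynomial.eval_map_algebraMap, Polynomial.eval_map_algebraMap, hχ, sub_zero,
    Polynomial.aeval_algebraMap_apply_eq_algebraMap_eval] at h

end ZeroDimensional

section Presentation

open IsLocalRing

variable {ι V S R : Type*} [CommRing V] [CommRing S] [Algebra V S] [CommRing R] [Algebra V R]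
  {x : ι → S} {φ : S →ₐ[V] R}

theorem exists_map_dotProduct_eq [Fintype ι] (hφ : Function.Surjective φ) {r : R}
    (hr : r ∈ Ideal.span (Set.range (φ ∘ x))) : ∃ p : ι → S, φ (p ⬝ᵥ x) = r := by
  obtain ⟨c, rfl⟩ := Ideal.mem_span_range_iff_exists_fun.mp hr
  choose p hp using fun i => hφ (c i)
  exact ⟨p, by simp only [dotProduct, map_sum, map_mul, hp, Function.comp_apply]⟩

variable [IsLocalRing R]

theorem algebraMap_mem_maximalIdeal [IsLocalRing V]
    (hres : Function.Surjective (algebraMap V (ResidueField R))) {π : V} (hπ : ¬ IsUnit π) :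
    algebraMap V R π ∈ maximalIdeal R := by
  have := IsLocalHom.of_surjective _ hres
  refine (mem_maximalIdeal _).mpr fun h => hπ ?_
  refine isUnit_of_map_unit (algebraMap V (ResidueField R)) _ ?_
  rw [IsScalarTower.algebraMap_apply V R]
  exact h.map _

variable [IsDomain V] [IsDiscreteValuationRing V]

theorem exists_irreducible_sub_dotProduct_mem_ker [Fintype ι] [Algebra.IsIntegral V S]
    (hφ : Function.Surjective φ) (hx : Ideal.span (Set.range (φ ∘ x)) = maximalIdeal R) {N : ℕ}
    (hN : maximalIdeal R ^ N = ⊥) (hres : Function.Surjective (algebraMap V (ResidueField R))) :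
    ∃ (τ c : V) (p : ι → S), Irreducible τ ∧ c ≠ 0 ∧
      φ (algebraMap V S τ - p ⬝ᵥ x) = 0 ∧ algebraMap V S τ - p ⬝ᵥ x ∣ algebraMap V S c := by
  obtain ⟨π, hπ⟩ := IsDiscreteValuationRing.exists_irreducible V
  have hπR := algebraMap_mem_maximalIdeal hres hπ.not_isUnit
  obtain ⟨p, hp⟩ := exists_map_dotProduct_eq hφ (hx ▸ hπR)
  have hintegral := Algebra.IsIntegral.isIntegral (R := V) (p ⬝ᵥ x)
  obtain ⟨τ, hτ, hdvd, heval⟩ :=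
    exists_irreducible_dvd_sub_eval_ne_zero hπ N (minpoly.ne_zero hintegral)
  refine ⟨τ, _, p, hτ, heval, ?_, sub_dvd_algebraMap_eval (minpoly.aeval V _) τ⟩
  have hπN : algebraMap V R (π ^ N) = 0 := by
    rw [map_pow, ← Ideal.mem_bot, ← hN]
    exact Ideal.pow_mem_pow hπR N
  have h := map_dvd (algebraMap V R) hdvd
  rw [hπN, zero_dvd_iff, map_sub] at h
  rw [map_sub, AlgHom.commutes, hp, h]

theorem exists_not_dvd_dvd_mul [IsNoetherianRing S] [Algebra.IsIntegral V S]
    (hφ : Function.Surjective φ) (hx : ∀ j, φ (x j) ∈ maximalIdeal R) {f : S} (hφf : φ f = 0)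
    {c : V} (hc : c ≠ 0) (hfc : f ∣ algebraMap V S c) {r : R} (hr : r ≠ 0) :
    ∃ t, ¬ f ∣ t ∧ (∀ j, f ∣ x j * t) ∧ φ t ∈ Ideal.span {r} := by
  let ψ : S ⧸ Ideal.span {f} →ₐ[V] R := Ideal.Quotient.liftₐ _ φ fun a ha => by
    obtain ⟨b, rfl⟩ := Ideal.mem_span_singleton.mp ha
    rw [map_mul, hφf, zero_mul]
  have : Ring.KrullDimLE 0 (S ⧸ Ideal.span {f}) := krullDimLE_zero_of_algebraMap_eq_zero hc
    (Ideal.Quotient.eq_zero_iff_mem.mpr (Ideal.mem_span_singleton.mpr hfc))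
  have : ((maximalIdeal R).comap ψ).IsPrime := Ideal.comap_isPrime _ _
  obtain ⟨s, rfl⟩ := hφ r
  obtain ⟨h, hh⟩ := exists_forall_mul_mul_eq_zero_iff (P := (maximalIdeal R).comap ψ)
    (x := Ideal.Quotient.mk _ s) fun u hu hunit => hr <| by
      have hus : ψ u * φ s = 0 := by rw [← map_zero ψ, ← hu, map_mul]; rfl
      exact hunit.mul_right_eq_zero.mp hus
  obtain ⟨h, rfl⟩ := Ideal.Quotient.mk_surjective h
  have hdvd : ∀ u, f ∣ u * (h * s) ↔ φ u ∈ maximalIdeal R := fun u => by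
    rw [← Ideal.mem_span_singleton, ← Ideal.Quotient.eq_zero_iff_mem, map_mul, map_mul]
    exact hh _
  refine ⟨h * s, fun hf => ?_, fun j => (hdvd _).mpr (hx j), ?_⟩
  · exact (mem_maximalIdeal _).mp ((hdvd 1).mp (hf.mul_left 1)) (map_one φ ▸ isUnit_one)
  · rw [map_mul]
    exact Ideal.mul_mem_left _ _ (Ideal.mem_span_singleton_self _)

theorem IsRelativeSocleGenerator.map_mem_span_singleton [Finite ι] [Module.Finite V S] {δ : S}
    (hδ : IsRelativeSocleGenerator V x δ)
    (hV : ∀ c : V, c ≠ 0 → algebraMap V S c ∈ nonZeroDivisors S) (hφ : Function.Surjective φ)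
    (hx : Ideal.span (Set.range (φ ∘ x)) = maximalIdeal R) {N : ℕ} (hN : maximalIdeal R ^ N = ⊥)
    (hres : Function.Surjective (algebraMap V (ResidueField R))) {r : R} (hr : r ≠ 0) :
    φ δ ∈ Ideal.span {r} := by
  cases nonempty_fintype ι
  obtain ⟨τ, c, p, hτ, hc, hφf, hfc⟩ :=
    exists_irreducible_sub_dotProduct_mem_ker hφ hx hN hres
  have : IsNoetherianRing S := IsNoetherianRing.of_finite V S
  obtain ⟨t, hft, hfxt, hφt⟩ := exists_not_dvd_dvd_mul hφ
    (fun j => hx.le (Ideal.subset_span ⟨j, rfl⟩)) hφf hc hfc hr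
  have hreg : algebraMap V S τ - p ⬝ᵥ x ∈ nonZeroDivisors S := by
    obtain ⟨g, hg⟩ := hfc
    exact (mul_mem_nonZeroDivisors.mp (hg ▸ hV c hc)).1
  obtain ⟨v, hv⟩ := hδ.exists_sub_dvd_sub_smul (hV τ hτ.ne_zero) hreg hfxt
  have hunit : IsUnit v := by
    by_contra hv'
    obtain ⟨w, rfl⟩ : τ ∣ v := by
      rw [← Ideal.mem_span_singleton, ← hτ.maximalIdeal_eq]
      exact hv'
    have h : (τ * w) • δ = (algebraMap V S τ - p ⬝ᵥ x) * (w • δ) := by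
      rw [Algebra.smul_def, Algebra.smul_def, map_mul]
      linear_combination algebraMap V S w * hδ.dotProduct_mul_eq_zero p
    exact hft ((dvd_sub_left (Dvd.intro _ h.symm)).mp hv)
  have hφδ : algebraMap V R v * φ δ = φ t := by
    have h := map_dvd φ hv
    rw [hφf, zero_dvd_iff, map_sub, map_smul, Algebra.smul_def, sub_eq_zero] at h
    exact h.symm
  exact (Ideal.unit_mul_mem_iff_mem _ (hunit.map (algebraMap V R))).mp (hφδ ▸ hφt)

end Presentation

section Surjectivity

open MvPolynomial IsLocalRing

variable {σ V R : Type*} [CommRing V] [CommRing R] [IsLocalRing R] [Algebra V R]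

theorem aeval_surjective_of_span_eq_maximalIdeal [Finite σ] {z : σ → R}
    (hz : Ideal.span (Set.range z) = maximalIdeal R) {N : ℕ} (hN : maximalIdeal R ^ N = ⊥)
    (hres : Function.Surjective (algebraMap V (ResidueField R))) :
    Function.Surjective (aeval z : MvPolynomial σ V →ₐ[V] R) := by
  cases nonempty_fintype σ
  have happrox : ∀ i r, ∃ s : MvPolynomial σ V, r - aeval z s ∈ maximalIdeal R ^ i := fun i => by
    induction i with
    | zero => exact fun r => ⟨0, by simp⟩
    | succ i ih =>
      intro r
      obtain ⟨v, hv⟩ := hres (residue R r)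
      rw [IsScalarTower.algebraMap_apply V R, ← sub_eq_zero, ← neg_sub, neg_eq_zero] at hv
      have hrv : r - algebraMap V R v ∈ maximalIdeal R := (residue_eq_zero_iff _).mp hv
      obtain ⟨c, hc⟩ := Ideal.mem_span_range_iff_exists_fun.mp (hz ▸ hrv)
      choose s hs using fun j => ih (c j)
      refine ⟨C v + ∑ j, s j * X j, ?_⟩
      have hdiff : r - aeval z (C v + ∑ j, s j * X j) = ∑ j, (c j - aeval z (s j)) * z j := by
        simp only [sub_mul, Finset.sum_sub_distrib, hc, map_add, map_sum, map_mul, aeval_X,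
          aeval_C]
        ring
      rw [hdiff, pow_succ]
      exact sum_mem fun j _ => Ideal.mul_mem_mul (hs j) (hz ▸ Ideal.subset_span ⟨j, rfl⟩)
  intro r
  obtain ⟨s, hs⟩ := happrox N r
  rw [hN, Ideal.mem_bot, sub_eq_zero] at hs
  exact ⟨s, hs.symm⟩

end Surjectivity

section LiftedMatrix

open MvPolynomial

variable {σ V R : Type*} [CommRing V] [CommRing R] [Algebra V R] [DecidableEq σ]

theorem exists_hasDiagonalLeadingForm_map_eq [Finite σ] {φ : MvPolynomial σ V →ₐ[V] R}
    (hφ : Function.Surjective φ) {N : ℕ} (hN : ∀ i, φ (X i) ^ N = 0) (A : Matrix σ σ R) :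
    ∃ (A' : Matrix σ σ (MvPolynomial σ V)) (M : ℕ), HasDiagonalLeadingForm A' M ∧ A'.map φ = A := by
  cases nonempty_fintype σ
  choose B hB using fun i j => hφ (A i j)
  obtain ⟨e, he⟩ := (Set.finite_range fun ij : σ × σ => (B ij.1 ij.2).totalDegree).bddAbove
  refine ⟨Matrix.of B + Matrix.diagonal fun i => X i ^ (e + 1 + N), e + 1 + N,
    fun i j => ⟨?_, ?_⟩, ?_⟩
  · rw [Matrix.diagonal_apply]
    split_ifs
    · exact isHomogeneous_X_pow i _
    · exact isHomogeneous_zero _ _ _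
  · rw [Matrix.add_apply, add_sub_cancel_right]
    exact mem_degLT_of_totalDegree_lt ((he ⟨(i, j), rfl⟩).trans_lt (by lia))
  · ext i j
    rw [Matrix.map_apply, Matrix.add_apply, map_add, Matrix.of_apply, hB, Matrix.diagonal_apply]
    split_ifs
    · rw [map_pow, pow_add, hN, mul_zero, add_zero]
    · rw [map_zero, add_zero]

theorem HasDiagonalLeadingForm.isRelativeSocleGenerator [Fintype σ]
    {A : Matrix σ σ (MvPolynomial σ V)} {M : ℕ} (hA : HasDiagonalLeadingForm A M) :
    IsRelativeSocleGenerator V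
      (fun j => Ideal.Quotient.mk (Ideal.span (Set.range (A.mulVec X))) (X j))
      (Ideal.Quotient.mk _ A.det) where
  mul_eq_zero j := by
    rw [← map_mul]
    exact Ideal.Quotient.eq_zero_iff_mem.mpr (X_mul_det_mem_span A j)
  exists_dvd_sub_smul τ t ht := by
    obtain ⟨t, rfl⟩ := Ideal.Quotient.mk_surjective t
    have hdvd : ∀ u, algebraMap V _ τ ∣ Ideal.Quotient.mk (Ideal.span (Set.range (A.mulVec X))) u ↔
        u ∈ Ideal.span (Set.range (A.mulVec X)) ⊔ (Ideal.span {τ}).map C := fun u => by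
      have hspan : Ideal.span {algebraMap V (_ ⧸ Ideal.span (Set.range (A.mulVec X))) τ} =
          ((Ideal.span {τ}).map C).map
            (Ideal.Quotient.mk (Ideal.span (Set.range (A.mulVec X)))) := by
        rw [Ideal.map_span, Set.image_singleton, Ideal.map_span, Set.image_singleton]
        rfl
      rw [← Ideal.mem_span_singleton, hspan, ← Ideal.mem_comap,
        Ideal.comap_map_of_surjective' _ Ideal.Quotient.mk_surjective, Ideal.mk_ker, sup_comm]
    obtain ⟨v, hv⟩ := hA.exists_sub_C_mul_det_mem_sup (Ideal.span {τ}) fun j => (hdvd _).mp (ht j)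
    refine ⟨v, ?_⟩
    have h := (hdvd _).mpr hv
    rwa [map_sub, map_mul, ← algebraMap_eq, ← Ideal.Quotient.algebraMap_eq,
      ← IsScalarTower.algebraMap_apply, ← Algebra.smul_def] at h

end LiftedMatrix

section Determinant

open MvPolynomial IsLocalRing

variable {σ V R : Type*} [CommRing V] [IsDomain V] [IsDiscreteValuationRing V] [CommRing R]
  [IsLocalRing R] [Algebra V R] [Fintype σ] [DecidableEq σ]

theorem det_mem_span_singleton {z : σ → R} (hz : Ideal.span (Set.range z) = maximalIdeal R) {N : ℕ}
    (hN : maximalIdeal R ^ N = ⊥) (hres : Function.Surjective (algebraMap V (ResidueField R)))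
    {A : Matrix σ σ R} (hA : A.mulVec z = 0) {r : R} (hr : r ≠ 0) : A.det ∈ Ideal.span {r} := by
  let φ : MvPolynomial σ V →ₐ[V] R := aeval z
  have hφ : Function.Surjective φ := aeval_surjective_of_span_eq_maximalIdeal hz hN hres
  have hzN : ∀ i, φ (X i) ^ N = 0 := fun i => by
    rw [aeval_X, ← Ideal.mem_bot, ← hN]
    exact Ideal.pow_mem_pow (hz ▸ Ideal.subset_span ⟨i, rfl⟩) N
  obtain ⟨A', M, hA', rfl⟩ := exists_hasDiagonalLeadingForm_map_eq hφ hzN A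
  have hker : Ideal.span (Set.range (A'.mulVec X)) ≤ RingHom.ker φ := by
    rw [Ideal.span_le]
    rintro _ ⟨i, rfl⟩
    have h : φ (A'.mulVec X i) = (A'.map φ).mulVec (φ ∘ X) i :=
      RingHom.map_mulVec (φ : MvPolynomial σ V →+* R) A' X i
    have hX : φ ∘ X = z := funext (aeval_X z)
    rw [SetLike.mem_coe, RingHom.mem_ker, h, hX, hA, Pi.zero_apply]
  let ψ : MvPolynomial σ V ⧸ Ideal.span (Set.range (A'.mulVec X)) →ₐ[V] R :=
    Ideal.Quotient.liftₐ _ φ hker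
  have hψ : ψ (Ideal.Quotient.mk _ A'.det) = (A'.map φ).det := AlgHom.map_det φ A'
  have := finite_quotient_span_range hA'.mulVec_X M.succ_pos
  rw [← hψ]
  refine hA'.isRelativeSocleGenerator.map_mem_span_singleton (φ := ψ) (fun c hc => ?_)
    (Ideal.Quotient.lift_surjective_of_surjective _ _ hφ) ?_ hN hres hr
  · refine mem_nonZeroDivisors_iff_left.mpr fun s hs => ?_
    obtain ⟨s, rfl⟩ := Ideal.Quotient.mk_surjective s
    refine Ideal.Quotient.eq_zero_iff_mem.mpr (mem_span_range_of_C_mul_mem hA'.mulVec_X M.succ_pos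
      (mem_nonZeroDivisors_of_ne_zero hc) (Ideal.Quotient.eq_zero_iff_mem.mp ?_))
    rw [map_mul]
    exact hs
  · rw [← hz]
    congr 2
    exact funext (aeval_X z)

end Determinant

/-! ### Cohen rings -/

section PerfectFields

open MvPolynomial

theorem subsingleton_h1Cotangent_iff_mem_ker_sq (K A : Type*) [CommRing K] [CommRing A]
    [Algebra K A] :
    Subsingleton (Algebra.H1Cotangent K A) ↔ ∀ f : MvPolynomial A K, aeval id f = 0 →
      (∀ a, aeval id (pderiv a f) = 0) → f ∈ RingHom.ker (aeval (R := K) (id : A → A)) ^ 2 := by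
  let P := Algebra.Generators.self K A
  have hP (f : P.toExtension.ker) :
      P.toExtension.cotangentComplex (.mk f) = 0 ↔ ∀ a, aeval id (pderiv a f.1) = 0 := by
    rw [Algebra.Extension.cotangentComplex_mk, ← P.cotangentSpaceBasis.repr.map_eq_zero_iff,
      Finsupp.ext_iff]
    exact forall_congr' fun a => by
      rw [P.cotangentSpaceBasis_repr_one_tmul]
      rfl
  rw [Algebra.H1Cotangent, Algebra.Extension.subsingleton_h1Cotangent, injective_iff_map_eq_zero,
    Algebra.Extension.Cotangent.mk_surjective.forall]
  simp only [P, hP, Algebra.Extension.Cotangent.mk_eq_zero_iff]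
  exact ⟨fun h f hf => h ⟨f, hf⟩, fun h f => h f.1 f.2⟩

theorem formallySmooth_of_perfectField (K L : Type*) [Field K] [PerfectField K] [Field L]
    [Algebra K L] : Algebra.FormallySmooth K L := by
  refine ⟨inferInstance, (subsingleton_h1Cotangent_iff_mem_ker_sq K L).mpr fun f hf hd => ?_⟩
  let F : IntermediateField K L := IntermediateField.adjoin K (f.vars : Set L)
  have hsub : ∀ a ∈ f.vars, a ∈ F := fun a ha => IntermediateField.subset_adjoin _ _ ha
  have : Algebra.EssFiniteType K F :=
    IntermediateField.essFiniteType_iff.mpr (IntermediateField.fg_adjoin_finset f.vars)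
  obtain ⟨g, hg⟩ := exists_rename_eq_of_vars_subset_range f ((↑) : F → L) Subtype.val_injective
    fun a ha => ⟨⟨a, hsub a ha⟩, rfl⟩
  have haeval (p : MvPolynomial F K) :
      aeval (R := K) (id : L → L) (rename (↑) p) = (aeval (R := K) (id : F → F) p : F) := by
    rw [aeval_rename]
    exact (MvPolynomial.comp_aeval_apply (id : F → F) F.val p).symm
  have hgker : g ∈ RingHom.ker (aeval (R := K) (id : F → F)) ^ 2 := by
    refine (subsingleton_h1Cotangent_iff_mem_ker_sq K F).mp inferInstance g ?_ fun a => ?_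
    · exact Subtype.val_injective ((haeval g).symm.trans (hg ▸ hf))
    · refine Subtype.val_injective ((haeval _).symm.trans ?_)
      rw [← pderiv_rename Subtype.val_injective, hg, hd]
      rfl
  have hle : (RingHom.ker (aeval (R := K) (id : F → F))).map (rename ((↑) : F → L)) ≤
      RingHom.ker (aeval (R := K) (id : L → L)) :=
    Ideal.map_le_iff_le_comap.mpr fun p hp => by
      rw [Ideal.mem_comap, RingHom.mem_ker, haeval, RingHom.mem_ker.mp hp, ZeroMemClass.coe_zero]
  have hmap := Ideal.mem_map_of_mem (rename ((↑) : F → L)) hgker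
  rw [hg, Ideal.map_pow] at hmap
  exact Ideal.pow_right_mono hle 2 hmap

end PerfectFields

section NilpotentThickenings

open TensorProduct

theorem formallySmooth_tensorProduct_quotient_pow {A B : Type*} [CommRing A] [CommRing B]
    [Algebra A B] [Module.Flat A B] {I : Ideal A}
    (h : Algebra.FormallySmooth (A ⧸ I) ((A ⧸ I) ⊗[A] B)) (n : ℕ) :
    Algebra.FormallySmooth (A ⧸ I ^ (n + 1)) ((A ⧸ I ^ (n + 1)) ⊗[A] B) := by
  induction n with
  | zero => rwa [zero_add, pow_one]
  | succ n ih =>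
    have hle : I ^ (n + 1 + 1) ≤ I ^ (n + 1) := Ideal.pow_le_pow_right (Nat.le_succ _)
    let q : A ⧸ I ^ (n + 1 + 1) →ₐ[A] A ⧸ I ^ (n + 1) :=
      Ideal.Quotient.factorₐ A hle
    have hq : Function.Surjective q := Ideal.Quotient.factor_surjective hle
    have hker : RingHom.ker q.toRingHom = (I ^ (n + 1)).map (Ideal.Quotient.mk _) :=
      Ideal.Quotient.factor_ker hle
    rw [← RingHom.formallySmooth_algebraMap] at ih ⊢
    refine RingHom.FormallySmooth.of_flat_of_ker_eq_map_of_square_zero _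
      (RingHom.flat_algebraMap_iff.mpr inferInstance) q.toRingHom
      (Algebra.TensorProduct.map q (AlgHom.id A B)).toRingHom _ hq
      (TensorProduct.map_surjective hq Function.surjective_id) ?_ ?_ ?_ ih
    · ext x
      simp [Algebra.TensorProduct.algebraMap_def]
    · rw [hker, ← Ideal.map_pow, ← pow_mul,
        Ideal.map_mk_eq_bot_of_le (Ideal.pow_le_pow_right (by lia))]
    · exact Algebra.TensorProduct.rTensor_ker q hq

end NilpotentThickenings

section SeparatedQuotient

variable {W : Type*} [CommRing W] {π : W}

theorem mem_iInf_span_pow_iff_not_finiteMultiplicity {x : W} :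
    x ∈ ⨅ n : ℕ, Ideal.span {π ^ n} ↔ ¬ FiniteMultiplicity π x := by
  simp only [Submodule.mem_iInf, Ideal.mem_span_singleton, FiniteMultiplicity.not_iff_forall]

theorem mk_pow_dvd_mk_iff (n : ℕ) {x : W} :
    Ideal.Quotient.mk (⨅ n : ℕ, Ideal.span {π ^ n}) π ^ n ∣ Ideal.Quotient.mk _ x ↔
      π ^ n ∣ x := by
  refine ⟨fun ⟨c, hc⟩ => ?_, fun h => (map_pow (Ideal.Quotient.mk (⨅ n : ℕ, _)) π n) ▸ map_dvd _ h⟩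
  obtain ⟨c, rfl⟩ := Ideal.Quotient.mk_surjective c
  rw [← map_pow, ← map_mul, Ideal.Quotient.eq] at hc
  exact (dvd_sub_left (dvd_mul_right _ _)).mp
    (Ideal.mem_span_singleton.mp ((Submodule.mem_iInf _).mp hc n))

variable [IsDomain W]

theorem isDiscreteValuationRing_of_finiteMultiplicity (hπ : Prime π)
    (hdvd : ∀ x, ¬ IsUnit x → π ∣ x) (hfin : ∀ x ≠ 0, FiniteMultiplicity π x) :
    IsDiscreteValuationRing W := by
  refine .ofHasUnitMulPowIrreducibleFactorization ⟨π, hπ.irreducible, fun {x} hx => ?_⟩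
  obtain ⟨u, hu, hndvd⟩ := (hfin x hx).exists_eq_pow_mul_and_not_dvd
  exact ⟨_, (not_imp_comm.mp (hdvd u) hndvd).unit, hu.symm⟩

theorem isPrime_iInf_span_pow (hπ : Prime π) : (⨅ n : ℕ, Ideal.span {π ^ n}).IsPrime := by
  refine ⟨(Ideal.ne_top_iff_one _).mpr fun h => ?_, fun {x y} hxy => ?_⟩
  · exact mem_iInf_span_pow_iff_not_finiteMultiplicity.mp h
      ⟨0, by rw [zero_add, pow_one]; exact hπ.not_dvd_one⟩
  · simp only [mem_iInf_span_pow_iff_not_finiteMultiplicity] at hxy ⊢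
    by_contra! hc
    exact hxy (hπ.finiteMultiplicity_mul hc.1 hc.2)

theorem prime_mk_iInf_span_pow (hπ : Prime π) :
    Prime (Ideal.Quotient.mk (⨅ n : ℕ, Ideal.span {π ^ n}) π) := by
  have hmk (x : W) : Ideal.Quotient.mk (⨅ n : ℕ, Ideal.span {π ^ n}) π ∣ Ideal.Quotient.mk _ x ↔
      π ∣ x := by simpa only [pow_one] using mk_pow_dvd_mk_iff (π := π) 1
  refine ⟨fun h => ?_, fun h => ?_, fun a b hab => ?_⟩
  · have h2 : π ^ 2 ∣ π ^ 1 := by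
      rw [pow_one, ← Ideal.mem_span_singleton]
      exact (Submodule.mem_iInf _).mp (Ideal.Quotient.eq_zero_iff_mem.mp h) 2
    exact absurd ((pow_dvd_pow_iff hπ.ne_zero hπ.not_isUnit).mp h2) (by decide)
  · exact hπ.not_dvd_one ((hmk 1).mp h.dvd)
  · obtain ⟨a, rfl⟩ := Ideal.Quotient.mk_surjective a
    obtain ⟨b, rfl⟩ := Ideal.Quotient.mk_surjective b
    rw [← map_mul, hmk] at hab
    rw [hmk, hmk]
    exact hπ.dvd_or_dvd hab

theorem isDiscreteValuationRing_quotient_iInf_span_pow (hπ : Prime π)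
    (hdvd : ∀ x, ¬ IsUnit x → π ∣ x) [IsDomain (W ⧸ ⨅ n : ℕ, Ideal.span {π ^ n})] :
    IsDiscreteValuationRing (W ⧸ ⨅ n : ℕ, Ideal.span {π ^ n}) := by
  refine isDiscreteValuationRing_of_finiteMultiplicity (prime_mk_iInf_span_pow hπ)
    (fun x hx => ?_) fun x hx => ?_
  · obtain ⟨x, rfl⟩ := Ideal.Quotient.mk_surjective x
    exact map_dvd _ (hdvd x fun hu => hx (hu.map _))
  · obtain ⟨x, rfl⟩ := Ideal.Quotient.mk_surjective x
    rw [Ne, Ideal.Quotient.eq_zero_iff_mem, mem_iInf_span_pow_iff_not_finiteMultiplicity,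
      not_not] at hx
    exact hx.imp fun n hn => mt (mk_pow_dvd_mk_iff _).mp hn

end SeparatedQuotient

section ResidueRoots

open Polynomial IsLocalRing

/-- The property that every root in the residue field of a monic polynomial over `B`, simple or
not, lifts to a root in `B`. It replaces Hensel's lemma for inseparable residue extensions. -/
def LiftsResidueRoots (B : Type*) [CommRing B] [IsLocalRing B] : Prop :=
  ∀ (h : B[X]) (a : ResidueField B), h.Monic → aeval a h = 0 → ∃ θ, h.IsRoot θ ∧ residue B θ = a

theorem liftsResidueRoots_of_isAlgClosed {Ω : Type*} [Field Ω] [IsAlgClosed Ω]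
    (B : ValuationSubring Ω) : LiftsResidueRoots B := by
  intro h a hm ha
  induction hn : h.natDegree generalizing h with
  | zero =>
    rw [hm.natDegree_eq_zero.mp hn, map_one] at ha
    exact absurd ha one_ne_zero
  | succ n ih =>
    obtain ⟨x, hx⟩ := IsAlgClosed.exists_aeval_eq_zero Ω h
      (by rw [degree_eq_natDegree hm.ne_zero, hn]; exact_mod_cast n.succ_ne_zero)
    obtain ⟨θ, rfl⟩ := IsIntegrallyClosed.isIntegral_iff.mp (⟨h, hm, hx⟩ : IsIntegral B x)
    have hθ : h.IsRoot θ := FaithfulSMul.algebraMap_injective B Ω (by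
      rw [← aeval_algebraMap_apply_eq_algebraMap_eval, hx, map_zero])
    have hfac := mul_divByMonic_eq_iff_isRoot.mpr hθ
    by_cases hθa : residue B θ = a
    · exact ⟨θ, hθ, hθa⟩
    have hm' : (h /ₘ (X - C θ)).Monic := (monic_X_sub_C θ).of_mul_monic_left (hfac.symm ▸ hm)
    have ha' : aeval a (h /ₘ (X - C θ)) = 0 := by
      rw [← hfac, map_mul, mul_eq_zero] at ha
      refine ha.resolve_left fun h0 => hθa ?_
      rw [map_sub, aeval_X, aeval_C, sub_eq_zero] at h0
      exact h0.symm
    obtain ⟨η, hη, hηa⟩ := ih _ hm' ha'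
      (by rw [natDegree_divByMonic _ (monic_X_sub_C θ), hn, natDegree_X_sub_C, n.add_sub_cancel])
    exact ⟨η, by rw [← hfac, IsRoot, eval_mul, hη.eq_zero, mul_zero], hηa⟩

variable {A B : Type*} [CommRing A] [IsLocalRing A] [CommRing B] [IsLocalRing B] [Algebra A B]
  [IsLocalHom (algebraMap A B)]

theorem aeval_residue_map_residue (f : A[X]) (θ : B) :
    aeval (residue B θ) (f.map (residue A)) = residue B (aeval θ f) := by
  exact (aeval_map_algebraMap (ResidueField A) (residue B θ) f).trans
    (aeval_algebraMap_apply (ResidueField B) θ f)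

theorem LiftsResidueRoots.exists_lift_forall_aeval (hB : LiftsResidueRoots B)
    (a : ResidueField B) :
    ∃ θ : B, residue B θ = a ∧ ∀ f : A[X], residue B (aeval θ f) = 0 →
      ∃ g : A[X], g.map (residue A) = 0 ∧ aeval θ g = aeval θ f := by
  by_cases hintegral : IsIntegral (ResidueField A) a
  · obtain ⟨h, hmap, hdeg, hm⟩ := lifts_and_degree_eq_and_monic
      (map_surjective _ residue_surjective (minpoly (ResidueField A) a)) (minpoly.monic hintegral)
    obtain ⟨θ, hθ, rfl⟩ := hB (h.map (algebraMap A B)) a (hm.map _) (by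
      rw [aeval_map_algebraMap, ← aeval_map_algebraMap (ResidueField A)]
      exact hmap ▸ minpoly.aeval _ a)
    have hred (f : A[X]) : aeval θ (f %ₘ h) = aeval θ f := by
      rw [IsRoot, eval_map_algebraMap] at hθ
      exact aeval_modByMonic_eq_self_of_root hθ
    refine ⟨θ, rfl, fun f hf => ⟨f %ₘ h, ?_, hred f⟩⟩
    rw [← hred, ← aeval_residue_map_residue, map_modByMonic _ hm, hmap] at hf
    rw [map_modByMonic _ hm, hmap]
    by_contra h0
    exact (minpoly.degree_le_of_ne_zero _ _ h0 hf).not_gt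
      (degree_modByMonic_lt _ (minpoly.monic hintegral))
  · obtain ⟨θ, rfl⟩ := residue_surjective a
    refine ⟨θ, rfl, fun f hf => ⟨f, ?_, rfl⟩⟩
    rw [← aeval_residue_map_residue] at hf
    by_contra h0
    exact hintegral (isAlgebraic_iff_isIntegral.mp ⟨_, h0, hf⟩)

end ResidueRoots

section Unramified

open Polynomial IsLocalRing

variable {B : Type*} [CommRing B]

/-- The subring of fractions `x / s` in `B` with `x s ∈ W` and `s` a unit of `B`. -/
def unitLocalization (W : Subring B) : Subring B where
  carrier := {x | ∃ s ∈ W, IsUnit s ∧ s * x ∈ W}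
  zero_mem' := ⟨1, W.one_mem, isUnit_one, by rw [mul_zero]; exact W.zero_mem⟩
  one_mem' := ⟨1, W.one_mem, isUnit_one, by rw [mul_one]; exact W.one_mem⟩
  add_mem' := by
    rintro x y ⟨s, hs, hsu, hx⟩ ⟨t, ht, htu, hy⟩
    refine ⟨s * t, W.mul_mem hs ht, hsu.mul htu, ?_⟩
    convert W.add_mem (W.mul_mem ht hx) (W.mul_mem hs hy) using 1
    ring
  mul_mem' := by
    rintro x y ⟨s, hs, hsu, hx⟩ ⟨t, ht, htu, hy⟩
    refine ⟨s * t, W.mul_mem hs ht, hsu.mul htu, ?_⟩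
    rw [mul_mul_mul_comm]
    exact W.mul_mem hx hy
  neg_mem' := by
    rintro x ⟨s, hs, hsu, hx⟩
    exact ⟨s, hs, hsu, by rw [mul_neg]; exact W.neg_mem hx⟩

theorem le_unitLocalization (W : Subring B) : W ≤ unitLocalization W := fun x hx =>
  ⟨1, W.one_mem, isUnit_one, by rwa [one_mul]⟩

variable [IsLocalRing B]

/-- A subring `W` of the local ring `B` whose residues lie in the subfield `κ` and in which the
elements with zero residue form the ideal generated by `p`. -/
structure IsUnramifiedSubring (κ : Subfield (ResidueField B)) (p : ℕ) (W : Subring B) : Prop where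
  residue_mem : ∀ w ∈ W, residue B w ∈ κ
  exists_mul_eq : ∀ w ∈ W, residue B w = 0 → ∃ w' ∈ W, p * w' = w

variable {κ : Subfield (ResidueField B)} {p : ℕ} {W : Subring B}

theorem isUnramifiedSubring_bot [CharP (ResidueField B) p] : IsUnramifiedSubring κ p ⊥ where
  residue_mem w hw := by
    obtain ⟨n, rfl⟩ := Subring.mem_bot.mp hw
    rw [map_intCast]
    exact intCast_mem κ n
  exists_mul_eq w hw h0 := by
    obtain ⟨n, rfl⟩ := Subring.mem_bot.mp hw
    rw [map_intCast, CharP.intCast_eq_zero_iff _ p] at h0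
    obtain ⟨m, rfl⟩ := h0
    exact ⟨m, intCast_mem _ m, by push_cast; rfl⟩

theorem isUnramifiedSubring_sSup {c : Set (Subring B)} (hne : c.Nonempty)
    (hc : DirectedOn (· ≤ ·) c) (h : ∀ W ∈ c, IsUnramifiedSubring κ p W) :
    IsUnramifiedSubring κ p (sSup c) where
  residue_mem w hw := by
    obtain ⟨W, hWc, hwW⟩ := (Subring.mem_sSup_of_directedOn hne hc).mp hw
    exact (h W hWc).residue_mem w hwW
  exists_mul_eq w hw h0 := by
    obtain ⟨W, hWc, hwW⟩ := (Subring.mem_sSup_of_directedOn hne hc).mp hw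
    obtain ⟨w', hw', h1⟩ := (h W hWc).exists_mul_eq w hwW h0
    exact ⟨w', le_sSup hWc hw', h1⟩

theorem exists_maximal_isUnramifiedSubring [CharP (ResidueField B) p] :
    ∃ W : Subring B, Maximal (IsUnramifiedSubring κ p) W := by
  obtain ⟨W, -, hW⟩ := zorn_le_nonempty₀ {W | IsUnramifiedSubring κ p W}
    (fun c hc hch W hW => ⟨sSup c, isUnramifiedSubring_sSup ⟨W, hW⟩ hch.directedOn hc,
      fun _ => le_sSup⟩) ⊥ isUnramifiedSubring_bot
  exact ⟨W, hW⟩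

theorem IsUnramifiedSubring.unitLocalization (hW : IsUnramifiedSubring κ p W) :
    IsUnramifiedSubring κ p (unitLocalization W) where
  residue_mem := by
    rintro x ⟨s, hs, hsu, hx⟩
    have h := mul_mem (inv_mem (hW.residue_mem s hs)) (hW.residue_mem _ hx)
    rwa [map_mul, inv_mul_cancel_left₀ ((residue_ne_zero_iff_isUnit s).mpr hsu)] at h
  exists_mul_eq := by
    rintro x ⟨s, hs, ⟨u, rfl⟩, hx⟩ h0
    obtain ⟨y, hy, hxy⟩ := hW.exists_mul_eq _ hx (by rw [map_mul, h0, mul_zero])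
    refine ⟨↑u⁻¹ * y, ⟨u, hs, u.isUnit, by rwa [Units.mul_inv_cancel_left]⟩, ?_⟩
    rw [mul_left_comm, hxy, Units.inv_mul_cancel_left]

theorem isLocalHom_subtype_of_maximal (hW : Maximal (IsUnramifiedSubring κ p) W) :
    IsLocalHom W.subtype := by
  refine ⟨fun w ⟨u, hu⟩ => ?_⟩
  have hinv : (w : B) * ↑u⁻¹ = 1 := by rw [← W.subtype_apply, ← hu, u.mul_inv]
  have hmem : (↑u⁻¹ : B) ∈ W := hW.le_of_ge hW.prop.unitLocalization (le_unitLocalization W)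
    ⟨w, w.2, ⟨u, hu⟩, hinv ▸ W.one_mem⟩
  exact .of_mul_eq_one ⟨_, hmem⟩ (Subtype.ext hinv)

theorem exists_mem_residue_eq_of_maximal (hB : LiftsResidueRoots B)
    (hW : Maximal (IsUnramifiedSubring κ p) W) {a : ResidueField B} (ha : a ∈ κ) :
    ∃ w ∈ W, residue B w = a := by
  have : IsLocalHom (algebraMap W B) := isLocalHom_subtype_of_maximal hW
  have : IsLocalRing W := RingHom.domain_isLocalRing (algebraMap W B)
  obtain ⟨θ, rfl, hθ⟩ := hB.exists_lift_forall_aeval (A := W) a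
  let W' : Subring B := (aeval θ : W[X] →ₐ[W] B).range.toSubring
  have hW' : IsUnramifiedSubring κ p W' := by
    refine ⟨?_, ?_⟩
    · rintro _ ⟨f, rfl⟩
      change residue B (aeval θ f) ∈ κ
      rw [aeval_eq_sum_range, map_sum]
      refine sum_mem fun i _ => ?_
      rw [Algebra.smul_def, map_mul, map_pow]
      exact mul_mem (hW.prop.residue_mem _ (f.coeff i).2) (pow_mem ha i)
    · rintro _ ⟨f, rfl⟩ h0
      obtain ⟨g, hg0, hg⟩ := hθ f h0
      have hdvd : C (p : W) ∣ g := by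
        refine (C_dvd_iff_dvd_coeff _ _).mpr fun i => ?_
        have hi : residue W (g.coeff i) = 0 := by rw [← coeff_map, hg0, coeff_zero]
        obtain ⟨w, hw, h⟩ := hW.prop.exists_mul_eq _ (g.coeff i).2 (by
          rw [residue_eq_zero_iff] at hi ⊢
          exact map_mem_nonunits_iff (algebraMap W B) _ |>.mpr hi)
        exact ⟨⟨w, hw⟩, Subtype.ext (by rw [← h]; simp)⟩
      obtain ⟨q, rfl⟩ := hdvd
      refine ⟨aeval θ q, ⟨q, rfl⟩, ?_⟩
      rw [map_mul, aeval_C, map_natCast] at hg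
      exact hg
  exact ⟨θ, hW.le_of_ge hW' (fun w hw => ⟨C ⟨w, hw⟩, aeval_C θ _⟩) ⟨X, aeval_X θ⟩, rfl⟩

end Unramified

section CohenRing

open IsLocalRing

universe u

theorem exists_isLocalHom_liftsResidueRoots (A : Type u) [CommRing A] [IsDomain A]
    [IsLocalRing A] :
    ∃ (B : Type u) (_ : CommRing B) (_ : IsDomain B) (_ : IsLocalRing B) (f : A →+* B),
      Function.Injective f ∧ IsLocalHom f ∧ LiftsResidueRoots B := by
  let Ω := AlgebraicClosure (FractionRing A)
  obtain ⟨B, hB, hloc⟩ := exists_factor_valuationRing (algebraMap A Ω)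
  refine ⟨B, inferInstance, inferInstance, inferInstance,
    (algebraMap A Ω).codRestrict B.toSubring hB, fun x y hxy => ?_, hloc,
    liftsResidueRoots_of_isAlgClosed B⟩
  exact IsFractionRing.injective A (FractionRing A)
    ((algebraMap (FractionRing A) Ω).injective (congrArg Subtype.val hxy))

theorem nonempty_residueField_wittVector_ringEquiv (k : Type u) [Field k] (p : ℕ)
    [Fact p.Prime] [CharP k p] :
    ∃ _ : IsLocalRing (WittVector p k), Nonempty (ResidueField (WittVector p k) ≃+* k) := by
  let c : WittVector p k →+* k := WittVector.constantCoeff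
  have : IsLocalHom c := ⟨fun x hx => WittVector.isUnit_of_coeff_zero_ne_zero x hx.ne_zero⟩
  have hlocal : IsLocalRing (WittVector p k) := RingHom.domain_isLocalRing c
  exact ⟨hlocal, ⟨.ofBijective (ResidueField.lift c) ⟨RingHom.injective _, fun a =>
    ⟨residue _ (WittVector.teichmuller p a), WittVector.teichmuller_coeff_zero p a⟩⟩⟩⟩

theorem exists_ker_eq_span_natCast (k : Type u) [Field k] (p : ℕ) [Fact p.Prime] [CharP k p] :
    ∃ (W : Type u) (_ : CommRing W) (_ : IsDomain W) (ρ : W →+* k), Function.Surjective ρ ∧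
      IsLocalHom ρ ∧ RingHom.ker ρ = Ideal.span {(p : W)} ∧ (p : W) ≠ 0 := by
  obtain ⟨_, ⟨e⟩⟩ := nonempty_residueField_wittVector_ringEquiv k p
  obtain ⟨B, _, _, _, f, hf, _, hB⟩ := exists_isLocalHom_liftsResidueRoots (WittVector p k)
  let ι : k →+* ResidueField B := (ResidueField.map f).comp e.symm
  have : CharP (ResidueField B) p := charP_of_injective_ringHom ι.injective p
  obtain ⟨W, hW⟩ := exists_maximal_isUnramifiedSubring (κ := ι.fieldRange) (p := p)
  have := isLocalHom_subtype_of_maximal hW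
  let ρ : W →+* k := (ι.rangeRestrictFieldEquiv.symm : ι.fieldRange →+* k).comp
    (((residue B).comp W.subtype).codRestrict ι.fieldRange fun w => hW.prop.residue_mem w w.2)
  have hρ (w : W) : ι (ρ w) = residue B w :=
    congrArg Subtype.val (ι.rangeRestrictFieldEquiv.apply_symm_apply ⟨residue B w, _⟩)
  have hρ0 (w : W) : ρ w = 0 ↔ residue B w = 0 := by rw [← hρ, map_eq_zero_iff ι ι.injective]
  refine ⟨W, inferInstance, inferInstance, ρ, fun a => ?_, ⟨fun w hw => ?_⟩, ?_, fun h0 => ?_⟩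
  · obtain ⟨w, hw, h⟩ := exists_mem_residue_eq_of_maximal hB hW (ι.mem_fieldRange_self a)
    exact ⟨⟨w, hw⟩, ι.injective ((hρ _).trans h)⟩
  · exact isUnit_of_map_unit W.subtype w
      ((residue_ne_zero_iff_isUnit _).mp (mt (hρ0 w).mpr hw.ne_zero))
  · refine le_antisymm (fun w hw => ?_) ?_
    · obtain ⟨v, hv, h⟩ := hW.prop.exists_mul_eq w w.2 ((hρ0 w).mp hw)
      exact Ideal.mem_span_singleton.mpr ⟨⟨v, hv⟩, Subtype.ext (by simpa using h.symm)⟩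
    · rw [Ideal.span_singleton_le_iff_mem, RingHom.mem_ker, map_natCast, CharP.cast_eq_zero]
  · refine WittVector.p_nonzero p k (hf ?_)
    rw [map_natCast, map_zero]
    exact_mod_cast congrArg W.subtype h0

theorem exists_discreteValuationRing_of_ker_eq_span {W : Type u} [CommRing W] [IsDomain W]
    {k : Type*} [Field k] {ρ : W →+* k} (hρ : Function.Surjective ρ) [IsLocalHom ρ] {π : W}
    (hker : RingHom.ker ρ = Ideal.span {π}) (h0 : π ≠ 0) :
    ∃ (V : Type u) (_ : CommRing V) (_ : IsDomain V) (_ : IsDiscreteValuationRing V) (f : W →+* V),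
      Irreducible (f π) ∧ Nonempty (ResidueField V ≃+* k) := by
  have hπ : Prime π := (Ideal.span_singleton_prime h0).mp (hker ▸ RingHom.ker_isPrime ρ)
  have hdvd (x : W) (hx : ¬ IsUnit x) : π ∣ x := by
    rw [← Ideal.mem_span_singleton, ← hker, RingHom.mem_ker]
    by_contra h
    exact hx (isUnit_of_map_unit ρ x (Ne.isUnit h))
  let J : Ideal W := ⨅ n : ℕ, Ideal.span {π ^ n}
  have : J.IsPrime := isPrime_iInf_span_pow hπ
  have hJ : J ≤ RingHom.ker ρ := (iInf_le _ 1).trans (by rw [pow_one, hker])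
  have hdom : IsDomain (W ⧸ J) := Ideal.Quotient.isDomain J
  have hV : IsDiscreteValuationRing (W ⧸ J) :=
    isDiscreteValuationRing_quotient_iInf_span_pow hπ hdvd
  let ρ' : W ⧸ J →+* k := Ideal.Quotient.lift J ρ hJ
  have : IsLocalHom ρ' := ⟨fun x hx => by
    obtain ⟨x, rfl⟩ := Ideal.Quotient.mk_surjective x
    exact (isUnit_of_map_unit ρ x hx).map _⟩
  exact ⟨W ⧸ J, inferInstance, hdom, hV, Ideal.Quotient.mk J,
    (prime_mk_iInf_span_pow hπ).irreducible,
    ⟨.ofBijective (ResidueField.lift ρ') ⟨RingHom.injective _, fun a =>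
      (hρ a).imp' (fun w => residue _ (Ideal.Quotient.mk J w)) fun _ h => h⟩⟩⟩

theorem exists_discreteValuationRing (k : Type u) [Field k] (p : ℕ) [Fact p.Prime] [CharP k p] :
    ∃ (V : Type u) (_ : CommRing V) (_ : IsDomain V) (_ : IsDiscreteValuationRing V),
      Irreducible (p : V) ∧ Nonempty (ResidueField V ≃+* k) := by
  obtain ⟨W, _, _, ρ, hρ, _, hker, hp⟩ := exists_ker_eq_span_natCast k p
  obtain ⟨V, _, _, _, f, hf, e⟩ := exists_discreteValuationRing_of_ker_eq_span hρ hker hp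
  exact ⟨V, inferInstance, inferInstance, inferInstance, map_natCast f p ▸ hf, e⟩

end CohenRing

section Lifting

open IsLocalRing TensorProduct

universe u

theorem formallySmooth_quotient_tensorProduct_of_finite {A B : Type*} [CommRing A] [CommRing B]
    [Algebra A B] (I : Ideal A) [I.IsMaximal] [Finite (A ⧸ I)]
    [(I.map (algebraMap A B)).IsMaximal] :
    Algebra.FormallySmooth (A ⧸ I) ((A ⧸ I) ⊗[A] B) := by
  let : Field (A ⧸ I) := Ideal.Quotient.field I
  let : Field (B ⧸ I.map (algebraMap A B)) := Ideal.Quotient.field _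
  have : Algebra.FormallySmooth (A ⧸ I) (B ⧸ I.map (algebraMap A B)) :=
    formallySmooth_of_perfectField _ _
  exact .of_equiv (Algebra.TensorProduct.quotIdealMapEquivQuotTensor B I)

theorem exists_algHom_lift_of_flat {A B R : Type*} [CommRing A] [CommRing B] [CommRing R]
    [Algebra A B] [Algebra A R] [Module.Flat A B] {I : Ideal A}
    (h : Algebra.FormallySmooth (A ⧸ I) ((A ⧸ I) ⊗[A] B)) {J : Ideal R} (hJ : IsNilpotent J)
    (hIJ : I.map (algebraMap A R) ≤ J) (g : B →ₐ[A] R ⧸ J) :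
    ∃ φ : B →ₐ[A] R, (Ideal.Quotient.mkₐ A J).comp φ = g := by
  obtain ⟨n, hn⟩ := hJ
  let S := A ⧸ I ^ (n + 1)
  have hI : ∀ a ∈ I ^ (n + 1), algebraMap A R a = 0 := fun a ha => by
    have ha' := Ideal.pow_right_mono hIJ n
      (Ideal.map_pow (algebraMap A R) I n ▸
        Ideal.mem_map_of_mem _ (Ideal.pow_le_pow_right n.le_succ ha))
    rwa [hn] at ha'
  let : Algebra S R := (Ideal.Quotient.lift (I ^ (n + 1)) (algebraMap A R) hI).toAlgebra
  have : IsScalarTower A S R := .of_algebraMap_eq fun _ => rfl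
  have := formallySmooth_tensorProduct_quotient_pow h n
  obtain ⟨φ, hφ⟩ := Algebra.FormallySmooth.exists_lift (R := S) (A := S ⊗[A] B) J ⟨n, hn⟩
    (Algebra.TensorProduct.lift (Algebra.ofId S (R ⧸ J)) g fun _ _ => .all _ _)
  refine ⟨(φ.restrictScalars A).comp Algebra.TensorProduct.includeRight, AlgHom.ext fun b => ?_⟩
  simpa using AlgHom.congr_fun hφ (1 ⊗ₜ b)

theorem exists_ringHom_lift {V k R : Type*} [CommRing V] [IsDomain V] [CharZero V] [Field k]
    [CommRing R] {p : ℕ} [Fact p.Prime] {ρ : V →+* k} (hρ : Function.Surjective ρ)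
    (hker : RingHom.ker ρ = Ideal.span {(p : V)}) {J : Ideal R} (hJ : IsNilpotent J)
    (hpJ : (p : R) ∈ J) (ψ : k →+* R ⧸ J) :
    ∃ φ : V →+* R, (Ideal.Quotient.mk J).comp φ = ψ.comp ρ := by
  let I : Ideal ℤ := Ideal.span {(p : ℤ)}
  have hV : I.map (algebraMap ℤ V) = RingHom.ker ρ := by
    rw [hker, Ideal.map_span, Set.image_singleton, map_natCast]
  have hR : I.map (algebraMap ℤ R) ≤ J := by
    rwa [Ideal.map_span, Set.image_singleton, map_natCast, Ideal.span_singleton_le_iff_mem]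
  have : I.IsMaximal := Int.ideal_span_isMaximal_of_prime p
  have : Finite (ℤ ⧸ I) := .of_equiv _ (Int.quotientSpanNatEquivZMod p).symm.toEquiv
  have : (I.map (algebraMap ℤ V)).IsMaximal :=
    hV ▸ RingHom.ker_isMaximal_of_surjective ρ hρ
  obtain ⟨φ, hφ⟩ := exists_algHom_lift_of_flat (B := V)
    (formallySmooth_quotient_tensorProduct_of_finite I) hJ hR (ψ.comp ρ).toIntAlgHom
  exact ⟨φ, congrArg AlgHom.toRingHom hφ⟩

theorem charZero_of_natCast_ne_zero {V k : Type*} [CommRing V] [IsDomain V] [Field k]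
    (f : V →+* k) {p : ℕ} [hp : Fact p.Prime] [CharP k p] (hpV : (p : V) ≠ 0) : CharZero V := by
  obtain ⟨q, hq⟩ := CharP.exists V
  rcases CharP.char_is_prime_or_zero V q with hq' | rfl
  · have hpq : p ∣ q := by
      rw [← CharP.cast_eq_zero_iff k p, ← map_natCast f, CharP.cast_eq_zero, map_zero]
    rw [(Nat.prime_dvd_prime_iff_eq hp.out hq').mp hpq] at hpV
    exact absurd (CharP.cast_eq_zero V q) hpV
  · exact CharP.charP_to_charZero V

variable {R : Type u} [CommRing R] [IsLocalRing R]

theorem exists_ringHom_surjective_residue_of_charP (p : ℕ) [Fact p.Prime]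
    [CharP (ResidueField R) p] (hR : IsNilpotent (maximalIdeal R)) :
    ∃ (V : Type u) (_ : CommRing V) (_ : IsDomain V) (_ : IsDiscreteValuationRing V)
      (φ : V →+* R), Function.Surjective ((residue R).comp φ) := by
  obtain ⟨V, _, _, _, hp, ⟨e⟩⟩ := exists_discreteValuationRing (ResidueField R) p
  let ρ : V →+* ResidueField R := (e : ResidueField V →+* _).comp (residue V)
  have : CharZero V := charZero_of_natCast_ne_zero ρ hp.ne_zero
  have hρ : Function.Surjective ρ := e.surjective.comp residue_surjective
  have hker : RingHom.ker ρ = Ideal.span {(p : V)} := by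
    rw [← hp.maximalIdeal_eq, ← ker_residue]
    exact RingHom.ker_equiv_comp (residue V) e
  have hpR : (p : R) ∈ maximalIdeal R := by
    rw [← residue_eq_zero_iff, map_natCast, CharP.cast_eq_zero]
  obtain ⟨φ, hφ⟩ := exists_ringHom_lift hρ hker hR hpR (RingHom.id (ResidueField R))
  exact ⟨V, inferInstance, inferInstance, inferInstance, φ, fun a =>
    (hρ a).imp fun v hv => (RingHom.congr_fun hφ v).trans hv⟩

theorem exists_ringHom_surjective_residue_of_charZero [CharZero (ResidueField R)]
    (hR : IsNilpotent (maximalIdeal R)) :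
    ∃ (V : Type u) (_ : CommRing V) (_ : IsDomain V) (_ : IsDiscreteValuationRing V)
      (φ : V →+* R), Function.Surjective ((residue R).comp φ) := by
  obtain ⟨_⟩ : Nonempty (Algebra ℚ R) := by
    rw [EqualCharZero.nonempty_algebraRat_iff]
    intro I hI
    let g : R ⧸ I →+* ResidueField R := Ideal.Quotient.factor (le_maximalIdeal hI)
    exact g.charZero
  have := formallySmooth_of_perfectField ℚ (ResidueField R)
  obtain ⟨f, hf⟩ := Algebra.FormallySmooth.exists_lift (R := ℚ) (maximalIdeal R) hR
    (RingHom.toRatAlgHom (RingHom.id (ResidueField R)) : ResidueField R →ₐ[ℚ] R ⧸ maximalIdeal R)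
  exact ⟨PowerSeries (ResidueField R), inferInstance, inferInstance, inferInstance,
    (f : ResidueField R →+* R).comp PowerSeries.constantCoeff, fun a =>
      ⟨PowerSeries.C a, (congrArg (fun a => residue R (f a)) (PowerSeries.constantCoeff_C a)).trans
        (AlgHom.congr_fun hf a)⟩⟩

theorem exists_ringHom_surjective_residue (hR : IsNilpotent (maximalIdeal R)) :
    ∃ (V : Type u) (_ : CommRing V) (_ : IsDomain V) (_ : IsDiscreteValuationRing V)
      (φ : V →+* R), Function.Surjective ((residue R).comp φ) := by
  obtain ⟨p, hp⟩ := CharP.exists (ResidueField R)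
  rcases CharP.char_is_prime_or_zero (ResidueField R) p with h | rfl
  · have : Fact p.Prime := ⟨h⟩
    exact exists_ringHom_surjective_residue_of_charP p hR
  · have := CharP.charP_to_charZero (ResidueField R)
    exact exists_ringHom_surjective_residue_of_charZero hR

end Lifting

/-! ### Matrices annihilating the maximal ideal -/

section DeterminantVanishing

open IsLocalRing

variable {R : Type*} [CommRing R] [IsLocalRing R] [IsNoetherianRing R]

theorem pow_succ_maximalIdeal_lt_pow (hdim : 0 < ringKrullDim R) (N : ℕ) :
    maximalIdeal R ^ (N + 1) < maximalIdeal R ^ N := by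
  refine lt_of_le_of_ne (Ideal.pow_le_pow_right N.le_succ) fun h => hdim.not_ge ?_
  have hbot : maximalIdeal R ^ N = ⊥ :=
    Submodule.eq_bot_of_le_smul_of_le_jacobson_bot (maximalIdeal R) _ (IsNoetherian.noetherian _)
      (by rw [smul_eq_mul, ← pow_succ', h]) (maximalIdeal_le_jacobson _)
  have : IsArtinianRing R := (isArtinianRing_iff_isNilpotent_maximalIdeal R).mpr ⟨N, hbot⟩
  exact Ring.krullDimLE_iff.mp (isArtinianRing_iff_krullDimLE_zero.mp this)

variable {σ : Type*} [Fintype σ] [DecidableEq σ] {z : σ → R} {A : Matrix σ σ R}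

theorem det_mem_pow_maximalIdeal (hdim : 0 < ringKrullDim R)
    (hz : Ideal.span (Set.range z) = maximalIdeal R) (hA : A.mulVec z = 0) (N : ℕ) :
    A.det ∈ maximalIdeal R ^ N := by
  set J := maximalIdeal R ^ (N + 1) with hJ
  have hlt : J < maximalIdeal R ^ N := pow_succ_maximalIdeal_lt_pow hdim N
  set q := Ideal.Quotient.mk J
  have hq : Function.Surjective q := Ideal.Quotient.mk_surjective
  have : Nontrivial (R ⧸ J) := Ideal.Quotient.nontrivial_iff.mpr (hlt.trans_le le_top).ne
  have : IsLocalRing (R ⧸ J) := IsLocalRing.of_surjective' q hq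
  have hmap : (maximalIdeal R).map q = maximalIdeal (R ⧸ J) := map_maximalIdeal_of_surjective q hq
  have hbot : maximalIdeal (R ⧸ J) ^ (N + 1) = ⊥ := by
    rw [← hmap, ← Ideal.map_pow, ← hJ, Ideal.map_quotient_self]
  obtain ⟨r, hr, hrJ⟩ := SetLike.exists_of_lt hlt
  obtain ⟨V, _, _, _, φ, hφ⟩ := exists_ringHom_surjective_residue ⟨N + 1, hbot⟩
  let _ : Algebra V (R ⧸ J) := φ.toAlgebra
  have hdet : (A.map q).det ∈ Ideal.span {q r} := by
    refine det_mem_span_singleton (V := V) (z := q ∘ z) ?_ hbot hφ ?_ ?_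
    · rw [Set.range_comp, ← Ideal.map_span, hz, hmap]
    · ext i
      rw [← RingHom.map_mulVec, hA]
      exact map_zero q
    · rwa [Ne, Ideal.Quotient.eq_zero_iff_mem]
  rw [← RingHom.mapMatrix_apply, ← RingHom.map_det, ← Set.image_singleton, ← Ideal.map_span,
    Ideal.mem_quotient_iff_mem_sup] at hdet
  exact sup_le ((Ideal.span_singleton_le_iff_mem _).mpr hr) hlt.le hdet

theorem det_eq_zero_of_mulVec_eq_zero (hdim : 0 < ringKrullDim R)
    (hz : Ideal.span (Set.range z) = maximalIdeal R) (hA : A.mulVec z = 0) : A.det = 0 := by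
  rw [← Ideal.mem_bot,
    ← Ideal.iInf_pow_eq_bot_of_isLocalRing (maximalIdeal R) Ideal.IsPrime.ne_top']
  exact Ideal.mem_iInf.mpr (det_mem_pow_maximalIdeal hdim hz hA)

end DeterminantVanishing

/-! ### Reductions -/

section Forms

open IsLocalRing MvPolynomial
open scoped Pointwise

variable {R : Type*} [CommRing R]

theorem map_sub_map_mem_mul_pow {S : Type*} [CommRing S] {f g : S →+* R} {I J : Ideal R}
    {K : Ideal S} (hf : K ≤ I.comap f) (hg : K ≤ I.comap g) (hfg : ∀ p, f p - g p ∈ J) {n : ℕ}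
    {p : S} (hp : p ∈ K ^ (n + 1)) : f p - g p ∈ J * I ^ n := by
  induction n generalizing p with
  | zero => simpa only [pow_zero, mul_one, Ideal.one_eq_top, Ideal.mul_top] using hfg p
  | succ n ih =>
    rw [pow_succ'] at hp
    refine Submodule.mul_induction_on hp (fun a ha b hb => ?_) fun a b ha hb => ?_
    · have h₁ : (f a - g a) * f b ∈ J * I ^ (n + 1) :=
        Ideal.mul_mem_mul (hfg a) (((Ideal.pow_right_mono hf _).trans (Ideal.le_comap_pow f _)) hb)
      have h₂ : (f b - g b) * g a ∈ J * I ^ (n + 1) := by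
        rw [pow_succ, ← mul_assoc]
        exact Ideal.mul_mem_mul (ih hb) (hg ha)
      convert add_mem h₁ h₂ using 1
      rw [map_mul, map_mul]
      ring
    · rw [map_add, map_add, add_sub_add_comm]
      exact add_mem ha hb

variable {ι : Type*} {F : MvPolynomial ι R} {n : ℕ}

theorem eval_sub_eval_mem {ω η : ι → R} {I J : Ideal R} (hω : ∀ i, ω i ∈ I) (hη : ∀ i, η i ∈ I)
    (h : ∀ i, ω i - η i ∈ J) (hF : F.IsHomogeneous (n + 1)) :
    eval ω F - eval η F ∈ J * I ^ n := by
  have hle (ξ : ι → R) (hξ : ∀ i, ξ i ∈ I) : idealOfVars ι R ≤ I.comap (eval ξ) := by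
    rw [idealOfVars, Ideal.span_le]
    rintro _ ⟨i, rfl⟩
    simpa using hξ i
  have heq : (Ideal.Quotient.mk J).comp (eval ω) = (Ideal.Quotient.mk J).comp (eval η) := by
    refine ringHom_ext (fun r => by simp) fun i => ?_
    simpa [Ideal.Quotient.eq] using h i
  refine map_sub_map_mem_mul_pow (hle ω hω) (hle η hη)
    (fun p => Ideal.Quotient.eq.mp (DFunLike.congr_fun heq p)) ?_
  exact (mem_pow_idealOfVars_iff _ _).mpr fun α hα =>
    (hF.degree_eq_sum_deg_support hα).le

theorem eval_mul_right_of_isHomogeneous (hF : F.IsHomogeneous n) (μ : ι → R) (y : R) :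
    eval (fun i => μ i * y) F = eval μ F * y ^ n := by
  rw [eval_eq, eval_eq, Finset.sum_mul]
  refine Finset.sum_congr rfl fun α hα => ?_
  have hdeg : ∑ i ∈ α.support, α i = n := (hF.degree_eq_sum_deg_support hα).symm
  simp only [mul_pow, Finset.prod_mul_distrib, Finset.prod_pow_eq_pow_sum, hdeg, mul_assoc]

theorem span_image_mul_span_range_pow (ω : ι → R) (s : Set ι) (n : ℕ) :
    Ideal.span (ω '' s) * Ideal.span (Set.range ω) ^ n =
      (restrictSupport R ((fun i => Finsupp.single i 1) '' s + {β | β.degree = n})).map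
        (aeval ω : MvPolynomial ι R →ₐ[R] R).toLinearMap := by
  rw [restrictSupport_add, Submodule.map_mul]
  congr 1
  · rw [restrictSupport_eq_span, Submodule.map_span, Set.image_image, Set.image_image]
    simp [Ideal.span, MvPolynomial.aeval_monomial]
  · rw [Ideal.span_pow_eq_map_homogeneousSubmodule, homogeneousSubmodule_eq_finsupp_supported]
    rfl

theorem aeval_mem_mul_map_restrictSupport {J : Ideal R} {S : Set (ι →₀ ℕ)} (ω : ι → R)
    (hF : F ∈ restrictSupport R S) (hJ : ∀ α, F.coeff α ∈ J) :
    aeval ω F ∈ J * (restrictSupport R S).map (aeval ω : MvPolynomial ι R →ₐ[R] R).toLinearMap := by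
  rw [F.as_sum, map_sum]
  refine sum_mem fun α hα => ?_
  rw [← mul_one (F.coeff α), ← smul_eq_mul (F.coeff α), ← smul_monomial, map_smul]
  refine Ideal.mul_mem_mul (hJ α) (Submodule.mem_map_of_mem ?_)
  rw [restrictSupport_eq_span]
  exact Submodule.subset_span ⟨α, (mem_restrictSupport_iff R).mp hF hα, rfl⟩

variable [IsLocalRing R]

theorem exists_isHomogeneous_map_residue_ne_zero {ω : ι → R} {s : Set ι} {w : R}
    (hw : w ∈ Ideal.span (ω '' s) * Ideal.span (Set.range ω) ^ n)
    (hw' : w ∉ maximalIdeal R * (Ideal.span (ω '' s) * Ideal.span (Set.range ω) ^ n)) :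
    ∃ F : MvPolynomial ι R, F.IsHomogeneous (n + 1) ∧ map (residue R) F ≠ 0 ∧ eval ω F = w := by
  rw [span_image_mul_span_range_pow] at hw hw'
  obtain ⟨F, hF, rfl⟩ := hw
  refine ⟨F, ?_, fun h0 => hw' ?_, rfl⟩
  · rw [← mem_homogeneousSubmodule, homogeneousSubmodule_eq_finsupp_supported]
    refine restrictSupport_mono R ?_ hF
    rintro _ ⟨_, ⟨i, _, rfl⟩, β, rfl, rfl⟩
    change (Finsupp.single i 1 + β).degree = β.degree + 1
    rw [map_add, Finsupp.degree_single, add_comm]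
  · refine aeval_mem_mul_map_restrictSupport ω hF fun α => ?_
    rw [← residue_eq_zero_iff, ← coeff_map, h0, coeff_zero]

end Forms

section Reductions

open IsLocalRing MvPolynomial

variable {R : Type*} [CommRing R]

theorem sup_pow_succ_le (J K : Ideal R) (n : ℕ) :
    (J ⊔ K) ^ (n + 1) ≤ J * (J ⊔ K) ^ n ⊔ K ^ (n + 1) := by
  induction n with
  | zero => simp only [zero_add, pow_one, pow_zero, mul_one, le_refl]
  | succ n ih =>
    have hK : K * (J ⊔ K) ^ (n + 1) ≤ J * (J ⊔ K) ^ (n + 1) ⊔ K ^ (n + 2) :=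
      calc K * (J ⊔ K) ^ (n + 1) ≤ K * (J * (J ⊔ K) ^ n ⊔ K ^ (n + 1)) := Ideal.mul_mono_right ih
        _ = J * (K * (J ⊔ K) ^ n) ⊔ K ^ (n + 2) := by
          rw [Ideal.mul_sup, mul_left_comm, ← pow_succ']
        _ ≤ J * (J ⊔ K) ^ (n + 1) ⊔ K ^ (n + 2) := by
          rw [pow_succ' (J ⊔ K)]
          gcongr
          exact le_sup_right
    rw [pow_succ' (J ⊔ K) (n + 1), Ideal.sup_mul]
    exact sup_le le_sup_left hK

/-- The `2 × 2` minors of the matrix with rows `μ` and `ω` that involve the column `j`. -/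
def columnMinors {d : ℕ} (μ ω : Fin (d + 1) → R) (j : Fin (d + 1)) (i : Fin d) : R :=
  μ j * ω (j.succAbove i) - μ (j.succAbove i) * ω j

theorem mul_sub_mul_mem_span_columnMinors {d : ℕ} (μ ω : Fin (d + 1) → R) (j i : Fin (d + 1)) :
    μ j * ω i - μ i * ω j ∈ Ideal.span (Set.range (columnMinors μ ω j)) := by
  obtain rfl | ⟨i, rfl⟩ := Fin.eq_self_or_eq_succAbove j i
  · rw [sub_self]
    exact zero_mem _
  · exact Ideal.subset_span ⟨i, rfl⟩

theorem span_range_eq_sup_span_singleton {d : ℕ} {μ ω : Fin (d + 1) → R} {j : Fin (d + 1)}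
    (hμ : IsUnit (μ j)) :
    Ideal.span (Set.range ω) =
      Ideal.span (Set.range (columnMinors μ ω j)) ⊔ Ideal.span {ω j} := by
  refine le_antisymm (Ideal.span_le.mpr ?_) (sup_le (Ideal.span_le.mpr ?_) (Ideal.span_mono ?_))
  · rintro _ ⟨i, rfl⟩
    refine (Ideal.unit_mul_mem_iff_mem _ hμ).mp ?_
    rw [← sub_add_cancel (μ j * ω i) (μ i * ω j)]
    exact Submodule.add_mem_sup (mul_sub_mul_mem_span_columnMinors μ ω j i)
      (Ideal.mul_mem_left _ _ (Ideal.mem_span_singleton_self _))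
  · rintro _ ⟨i, rfl⟩
    exact sub_mem (Ideal.mul_mem_left _ _ (Ideal.subset_span ⟨_, rfl⟩))
      (Ideal.mul_mem_left _ _ (Ideal.subset_span ⟨j, rfl⟩))
  · exact Set.singleton_subset_iff.mpr ⟨j, rfl⟩

variable [IsLocalRing R] {ι : Type*} {F : MvPolynomial ι R} {n : ℕ}

theorem exists_isUnit_eval [Infinite (ResidueField R)] (hF : F.IsHomogeneous (n + 1))
    (hF0 : map (residue R) F ≠ 0) :
    ∃ μ : ι → R, IsUnit (eval μ F) ∧ ∃ j, IsUnit (μ j) := by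
  obtain ⟨l, hl⟩ : ∃ l, eval l (map (residue R) F) ≠ 0 := by
    by_contra! h
    exact hF0 ((hF.map _).eq_zero_of_forall_eval_eq_zero h)
  obtain ⟨μ, rfl⟩ := residue_surjective.comp_left l
  refine ⟨μ, ?_, ?_⟩
  · rwa [← residue_ne_zero_iff_isUnit, eval₂_comp, ← eval_map]
  · by_contra! h
    have h0 : (residue R ∘ μ) = 0 :=
      funext fun j => (residue_eq_zero_iff _).mpr ((mem_maximalIdeal _).mpr (h j))
    refine hl ?_
    dsimp only
    rw [h0, eval_zero, constantCoeff_eq]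
    exact (hF.map _).coeff_eq_zero (by simp)

variable [IsNoetherianRing R]

theorem le_of_le_sup_maximalIdeal_mul {I J : Ideal R} (h : I ≤ J ⊔ maximalIdeal R * I) : I ≤ J :=
  Submodule.le_of_le_smul_of_le_jacobson_bot (IsNoetherian.noetherian I)
    (maximalIdeal_le_jacobson _) h

theorem pow_succ_eq_mul_of_pow_mem {I J : Ideal R} {x : R} (hI : I = J ⊔ Ideal.span {x})
    (hx : x ^ (n + 1) ∈ J * I ^ n ⊔ maximalIdeal R * I ^ (n + 1)) : I ^ (n + 1) = J * I ^ n := by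
  refine le_antisymm (le_of_le_sup_maximalIdeal_mul ?_) ?_
  · have h := sup_pow_succ_le J (Ideal.span {x}) n
    rw [← hI, Ideal.span_singleton_pow] at h
    exact h.trans (sup_le le_sup_left ((Ideal.span_singleton_le_iff_mem _).mpr hx))
  · rw [pow_succ']
    exact Ideal.mul_mono_left (hI ▸ le_sup_left)

theorem exists_pow_eq_mul_of_eval_mem [Infinite (ResidueField R)] {d : ℕ} {ω : Fin (d + 1) → R}
    {I : Ideal R} (hI : I = Ideal.span (Set.range ω)) {F : MvPolynomial (Fin (d + 1)) R}
    (hF : F.IsHomogeneous (n + 1)) (hF0 : map (residue R) F ≠ 0)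
    (hFω : eval ω F ∈ maximalIdeal R * I ^ (n + 1)) :
    ∃ b : Fin d → R, Ideal.span (Set.range b) ≤ I ∧
      I ^ (n + 1) = Ideal.span (Set.range b) * I ^ n := by
  obtain ⟨μ, hμF, j, hμj⟩ := exists_isUnit_eval hF hF0
  have hω (i) : ω i ∈ I := hI ▸ Ideal.subset_span ⟨i, rfl⟩
  set J := Ideal.span (Set.range (columnMinors μ ω j))
  have hIJ : I = J ⊔ Ideal.span {ω j} := hI.trans (span_range_eq_sup_span_singleton hμj)
  refine ⟨columnMinors μ ω j, hIJ ▸ le_sup_left, pow_succ_eq_mul_of_pow_mem hIJ ?_⟩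
  have hsub : eval ω F * μ j ^ (n + 1) - eval μ F * ω j ^ (n + 1) ∈ J * I ^ n := by
    rw [← eval_mul_right_of_isHomogeneous hF, ← eval_mul_right_of_isHomogeneous hF]
    refine eval_sub_eval_mem (fun i => Ideal.mul_mem_right _ _ (hω i))
      (fun i => Ideal.mul_mem_left _ (μ i) (hω j)) (fun i => ?_) hF
    rw [mul_comm (ω i)]
    exact mul_sub_mul_mem_span_columnMinors μ ω j i
  rw [← Ideal.unit_mul_mem_iff_mem _ hμF]
  have hmem := Submodule.add_mem_sup (neg_mem hsub) (Ideal.mul_mem_right (μ j ^ (n + 1)) _ hFω)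
  rwa [neg_sub, sub_add_cancel] at hmem

end Reductions

section MinimalGenerators

open IsLocalRing

variable {R M : Type*} [CommRing R] [IsLocalRing R] [AddCommGroup M] [Module R M]

theorem exists_ncard_eq_spanFinrank_and_le_sup {L : Submodule R M} (hL : L.FG)
    (N : Submodule R L) :
    ∃ b : Set L, b.ncard = L.spanFinrank ∧ Submodule.span R b = ⊤ ∧
      N ≤ Submodule.span R (b ∩ N) ⊔ maximalIdeal R • ⊤ := by
  have : Module.Finite R L := Module.Finite.iff_fg.mpr hL
  let _ : Field (R ⧸ maximalIdeal R) := Ideal.Quotient.field _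
  set π := (maximalIdeal R • (⊤ : Submodule R L)).mkQ with hπ
  have hspan (s : Set L) : (Submodule.span (R ⧸ maximalIdeal R) (π '' s)).restrictScalars R =
      (Submodule.span R s).map π := by
    rw [Submodule.restrictScalars_span R _ Ideal.Quotient.mk_surjective, Submodule.map_span]
  obtain ⟨c, hcN, -, hNc, hc⟩ := exists_linearIndepOn_extension
    (linearIndepOn_empty (R ⧸ maximalIdeal R) π) (Set.empty_subset (N : Set L))
  obtain ⟨b, -, hcb, hb_univ, hb⟩ := exists_linearIndepOn_extension hc (Set.subset_univ c)
  have hb_top : Submodule.span (R ⧸ maximalIdeal R) (π '' b) = ⊤ := by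
    rw [eq_top_iff, ← SetLike.coe_subset_coe, Submodule.top_coe,
      ← (Submodule.mkQ_surjective _).range_eq, ← Set.image_univ]
    exact hb_univ
  refine ⟨b, ?_, ?_, ?_⟩
  · have hbasis := Module.finrank_eq_nat_card_basis
      (Module.Basis.mk hb (by rw [← Set.image_eq_range, hb_top]))
    rw [spanFinrank_eq_finrank_quotient L hL, hbasis, Nat.card_coe_set_eq]
  · rw [← map_mkQ_eq_top, ← hspan, hb_top, Submodule.restrictScalars_top]
  · rw [← (maximalIdeal R • (⊤ : Submodule R L)).ker_mkQ, ← hπ, ← LinearMap.map_le_map_iff,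
      ← hspan, ← SetLike.coe_subset_coe]
    exact hNc.trans (Submodule.span_mono (Set.image_mono (Set.subset_inter hcb hcN)))

theorem exists_span_eq_and_le_span_inter {L N : Submodule R M} (hL : L.FG) (h : N ≤ L) :
    ∃ b : Set M, b.ncard = L.spanFinrank ∧ Submodule.span R b = L ∧
      N ≤ Submodule.span R (b ∩ N) ⊔ maximalIdeal R • L := by
  obtain ⟨b, hcard, hspan, hN⟩ := exists_ncard_eq_spanFinrank_and_le_sup hL (N.submoduleOf L)
  refine ⟨L.subtype '' b, ?_, ?_, ?_⟩
  · rw [Set.ncard_image_of_injective _ L.injective_subtype, hcard]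
  · rw [← Submodule.map_span, hspan, Submodule.map_top, Submodule.range_subtype]
  · have hmap := Submodule.map_mono (f := L.subtype) hN
    rwa [Submodule.map_sup, Submodule.map_smul'', Submodule.map_top, Submodule.range_subtype,
      Submodule.map_span, Submodule.submoduleOf, Submodule.map_comap_subtype, inf_of_le_right h,
      Submodule.comap_coe, Set.image_inter_preimage] at hmap

end MinimalGenerators

section AlmostCompleteIntersections

open IsLocalRing

variable {R : Type*} [CommRing R]

theorem height_radical (I : Ideal R) : I.radical.height = I.height := by
  simp only [Ideal.height, Ideal.radical_minimalPrimes]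

theorem IsAlmostCompleteIntersection.ne_top {I : Ideal R} (hI : IsAlmostCompleteIntersection I) :
    I ≠ ⊤ := by
  rintro rfl
  rw [IsAlmostCompleteIntersection, Ideal.height_top, top_add] at hI
  exact ENat.natCast_ne_top _ hI

variable [IsLocalRing R] [IsNoetherianRing R] {I J Q : Ideal R} {k : ℕ}

theorem radical_eq_of_pow_succ_eq_mul (hJ : J ≤ I) (hQ : Q ≤ J ⊔ maximalIdeal R * I)
    (hk : I ^ (k + 1) = Q * I ^ k) : J.radical = I.radical := by
  refine le_antisymm (Ideal.radical_mono hJ) ?_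
  have hpow : I ^ (k + 1) ≤ J * I ^ k := le_of_le_sup_maximalIdeal_mul <|
    calc I ^ (k + 1) ≤ (J ⊔ maximalIdeal R * I) * I ^ k := hk.trans_le (Ideal.mul_mono_left hQ)
      _ = J * I ^ k ⊔ maximalIdeal R * I ^ (k + 1) := by rw [Ideal.sup_mul, mul_assoc, ← pow_succ']
  rw [← I.radical_pow k.succ_ne_zero]
  exact Ideal.radical_mono (hpow.trans Ideal.mul_le_left)

theorem height_le_spanFinrank_of_pow_succ_eq_mul (hI : I ≠ ⊤) (hJ : J ≤ I)
    (hQ : Q ≤ J ⊔ maximalIdeal R * I) (hk : I ^ (k + 1) = Q * I ^ k) :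
    I.height ≤ J.spanFinrank := by
  rw [← height_radical, ← radical_eq_of_pow_succ_eq_mul hJ hQ hk, height_radical]
  exact J.height_le_spanFinrank (ne_top_of_le_ne_top hI hJ)

theorem IsAlmostCompleteIntersection.exists_eq_sup_span_singleton
    (hI : IsAlmostCompleteIntersection I) (hQI : Q ≤ I) (hk : I ^ (k + 1) = Q * I ^ k) :
    ∃ x, I = Q ⊔ Ideal.span {x} := by
  obtain ⟨b, hcard, hspan, hQ⟩ := exists_span_eq_and_le_span_inter (IsNoetherian.noetherian I) hQI
  have hcard' : (b.ncard : ℕ∞) = I.height + 1 := by rw [hcard]; exact hI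
  have hfin : b.Finite := Set.finite_of_ncard_ne_zero fun h =>
    add_eq_zero.not.mpr (by simp) (hcard'.symm.trans (by rw [h, Nat.cast_zero]))
  have hinter : I.height ≤ (b ∩ Q).ncard :=
    (height_le_spanFinrank_of_pow_succ_eq_mul hI.ne_top
      ((Ideal.span_mono Set.inter_subset_left).trans_eq hspan) hQ hk).trans
      (Nat.cast_le.mpr (Submodule.spanFinrank_span_le_ncard_of_finite (hfin.inter_of_left _)))
  have hdiff : (b \ Q).ncard ≤ 1 := by
    have hle : b.ncard ≤ (b ∩ Q).ncard + 1 := by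
      exact_mod_cast hcard'.trans_le (add_le_add_left hinter 1)
    have hadd := Set.ncard_inter_add_ncard_sdiff_eq_ncard b Q hfin
    lia
  have hsup : I = Q ⊔ Ideal.span (b \ Q) := by
    refine le_antisymm ?_ (sup_le hQI (hspan ▸ Submodule.span_mono Set.sdiff_subset))
    rw [← hspan, ← Ideal.span_eq Q, ← Ideal.span_union, Ideal.span_eq, Set.union_sdiff_self]
    exact Ideal.span_mono Set.subset_union_right
  obtain h | ⟨x, hx⟩ := (Set.ncard_le_one_iff_eq hfin.sdiff).mp hdiff
  · exact ⟨0, by rw [hsup, h, Ideal.span_empty, Ideal.span_singleton_zero]⟩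
  · exact ⟨x, by rw [hsup, hx]⟩

end AlmostCompleteIntersections

section ReductionNumbers

open IsLocalRing

variable {R : Type*} [CommRing R]

theorem pow_succ_mem_of_det_scalar_sub_eq_zero {σ : Type*} [Fintype σ] [DecidableEq σ]
    {J : Ideal R} {y : R} {B : Matrix σ σ R} (hB : ∀ i j, B i j ∈ J) {m : ℕ}
    (hσ : Fintype.card σ = m + 1) (h : (Matrix.scalar σ y - B).det = 0) :
    y ^ (m + 1) ∈ J * (J ⊔ Ideal.span {y}) ^ m := by
  nontriviality R
  have hmonic := B.charpoly_monic
  rw [Polynomial.Monic, Polynomial.leadingCoeff, Matrix.charpoly_natDegree_eq_dim, hσ] at hmonic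
  rw [← Matrix.eval_charpoly, Polynomial.eval_eq_sum_range, Matrix.charpoly_natDegree_eq_dim, hσ,
    Finset.sum_range_succ, hmonic, one_mul, add_comm, ← eq_neg_iff_add_eq_zero] at h
  rw [h]
  refine neg_mem (sum_mem fun i hi => ?_)
  obtain ⟨t, rfl⟩ := Nat.exists_eq_add_of_le (Nat.lt_succ_iff.mp (Finset.mem_range.mp hi))
  have hcoeff : B.charpoly.coeff i ∈ J ^ (t + 1) := by
    convert Matrix.coeff_charpoly_mem_ideal_pow hB i using 2
    lia
  have hy : y ^ i ∈ (J ⊔ Ideal.span {y}) ^ i :=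
    Ideal.pow_mem_pow (Ideal.mem_sup_right (Ideal.mem_span_singleton_self y)) i
  have hle : J ^ (t + 1) * (J ⊔ Ideal.span {y}) ^ i ≤ J * (J ⊔ Ideal.span {y}) ^ (i + t) := by
    rw [pow_succ', mul_assoc, add_comm, pow_add]
    gcongr
    exact le_sup_left
  exact hle (Ideal.mul_mem_mul hcoeff hy)

variable [IsLocalRing R]

theorem maximalIdeal_mul_le_of_length_eq_one {I J : Ideal R}
    (h : Module.length R (I ⧸ J.submoduleOf I) = 1) : maximalIdeal R * I ≤ J := by
  have : IsSimpleModule R (I ⧸ J.submoduleOf I) := Module.length_eq_one_iff.mp h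
  have hann : Module.annihilator R (I ⧸ J.submoduleOf I) = maximalIdeal R :=
    eq_maximalIdeal (IsSimpleModule.annihilator_isMaximal ..)
  refine Ideal.mul_le.mpr fun r hr y hy => ?_
  rw [← hann] at hr
  exact (Submodule.Quotient.mk_eq_zero (J.submoduleOf I)).mp
    (Module.mem_annihilator.mp hr (Submodule.Quotient.mk ⟨y, hy⟩))

variable [IsNoetherianRing R] {m n : ℕ}

theorem pow_succ_mem_of_span_mul_maximalIdeal_le (hdim : 0 < ringKrullDim R)
    (hm : (maximalIdeal R).spanFinrank = m + 1) {J : Ideal R} {y : R}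
    (h : Ideal.span {y} * maximalIdeal R ≤ J * maximalIdeal R) :
    y ^ (m + 1) ∈ J * (J ⊔ Ideal.span {y}) ^ m := by
  classical
  obtain ⟨t, ht, hspan⟩ := Submodule.FG.exists_span_finset_card_eq_spanFinrank
    (IsNoetherian.noetherian (maximalIdeal R))
  have hz : Ideal.span (Set.range ((↑) : t → R)) = maximalIdeal R := by
    rwa [Subtype.range_coe]
  have hmul (i : t) : ∃ c : t → R, (∀ j, c j ∈ J) ∧ ∑ j, c j * (j : R) = y * i := by
    have hmem : y * i ∈ J • Ideal.span (Set.range ((↑) : t → R)) := by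
      rw [hz]
      exact h (Ideal.mul_mem_mul (Ideal.mem_span_singleton_self y)
        (hspan ▸ Submodule.subset_span i.2))
    obtain ⟨c, hc, hci⟩ := (Submodule.mem_ideal_smul_span_iff_exists_sum _ _ _).mp hmem
    exact ⟨c, hc, by rw [← hci, Finsupp.sum_fintype _ _ (by simp)]; rfl⟩
  choose B hB hBz using hmul
  refine pow_succ_mem_of_det_scalar_sub_eq_zero (B := Matrix.of B) hB
    (by rw [Fintype.card_coe, ht, hm]) ?_
  refine det_eq_zero_of_mulVec_eq_zero hdim hz (funext fun i => ?_)
  rw [Matrix.sub_mulVec, Pi.sub_apply, Pi.zero_apply, sub_eq_zero, Matrix.scalar_apply,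
    Matrix.mulVec_diagonal]
  exact (hBz i).symm

theorem pow_eq_mul_of_maximalIdeal_mul_le (hdim : 0 < ringKrullDim R)
    (hm : (maximalIdeal R).spanFinrank = m + 1) {I Q : Ideal R} {x : R}
    (hI : I = Q ⊔ Ideal.span {x})
    (h : maximalIdeal R * I ^ (n + 1) ≤ maximalIdeal R * (Q * I ^ n)) :
    I ^ ((n + 1) * m + n + 1) = Q * I ^ ((n + 1) * m + n) := by
  have hx : Ideal.span {x ^ (n + 1)} ≤ I ^ (n + 1) := by
    rw [← Ideal.span_singleton_pow]
    exact Ideal.pow_right_mono (hI ▸ le_sup_right) _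
  have hQI : Q * I ^ n ≤ I ^ (n + 1) := by
    rw [pow_succ']
    exact Ideal.mul_mono_left (hI ▸ le_sup_left)
  refine pow_succ_eq_mul_of_pow_mem hI (Ideal.mem_sup_left ?_)
  have hmem := pow_succ_mem_of_span_mul_maximalIdeal_le hdim hm (J := Q * I ^ n) (y := x ^ (n + 1))
    (by
      rw [mul_comm, mul_comm _ (maximalIdeal R)]
      exact (Ideal.mul_mono_right hx).trans h)
  rw [← pow_mul, show (n + 1) * (m + 1) = (n + 1) * m + n + 1 by ring] at hmem
  refine (?_ : Q * I ^ n * _ ≤ _) hmem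
  rw [add_comm _ n, pow_add I, pow_mul, mul_assoc]
  gcongr
  exact sup_le hQI hx

theorem exists_pow_eq_mul_of_not_maximalIdeal_mul_le [Infinite (ResidueField R)] {d : ℕ}
    {a : Fin d → R} {x : R} {I : Ideal R} (hI : I = Ideal.span (Set.range a) ⊔ Ideal.span {x})
    (hle : maximalIdeal R * I ^ (n + 1) ≤ Ideal.span (Set.range a) * I ^ n)
    (h : ¬maximalIdeal R * I ^ (n + 1) ≤ maximalIdeal R * (Ideal.span (Set.range a) * I ^ n)) :
    ∃ b : Fin d → R, Ideal.span (Set.range b) ≤ I ∧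
      I ^ (n + 1) = Ideal.span (Set.range b) * I ^ n := by
  have hI' : I = Ideal.span (Set.range (Fin.cons x a : Fin (d + 1) → R)) := by
    rw [Fin.range_cons, Ideal.span_insert, hI, sup_comm]
  have ha : Set.range a = (Fin.cons x a : Fin (d + 1) → R) '' Set.range Fin.succ := by
    rw [← Set.range_comp]
    rfl
  obtain ⟨w, hw, hw'⟩ := SetLike.not_le_iff_exists.mp h
  have hwQ := hle hw
  rw [ha, hI'] at hwQ hw'
  obtain ⟨F, hF, hF0, rfl⟩ := exists_isHomogeneous_map_residue_ne_zero hwQ hw'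
  exact exists_pow_eq_mul_of_eval_mem hI' hF hF0 hw

theorem exists_pow_eq_mul_of_length_eq_one [Infinite (ResidueField R)] (hdim : 0 < ringKrullDim R)
    {d : ℕ} {a : Fin d → R} {x : R} {I : Ideal R}
    (hI : I = Ideal.span (Set.range a) ⊔ Ideal.span {x})
    (hlen : Module.length R
      (↥(I ^ (n + 1)) ⧸ (Ideal.span (Set.range a) * I ^ n).submoduleOf (I ^ (n + 1))) = 1) :
    ∃ b : Fin d → R, Ideal.span (Set.range b) ≤ I ∧
      ∃ k, k + 1 ≤ (n + 1) * (maximalIdeal R).spanFinrank ∧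
        I ^ (k + 1) = Ideal.span (Set.range b) * I ^ k := by
  obtain ⟨m, hm⟩ : ∃ m, (maximalIdeal R).spanFinrank = m + 1 := by
    refine Nat.exists_eq_succ_of_ne_zero fun h0 => hdim.not_ge ?_
    simpa [h0] using ringKrullDim_le_spanFinrank_maximalIdeal (R := R)
  rw [hm, mul_add_one]
  by_cases h : maximalIdeal R * I ^ (n + 1) ≤ maximalIdeal R * (Ideal.span (Set.range a) * I ^ n)
  · exact ⟨a, hI ▸ le_sup_left, _, le_rfl, pow_eq_mul_of_maximalIdeal_mul_le hdim hm hI h⟩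
  · obtain ⟨b, hb, hbn⟩ := exists_pow_eq_mul_of_not_maximalIdeal_mul_le hI
      (maximalIdeal_mul_le_of_length_eq_one hlen) h
    exact ⟨b, hb, n, by lia, hbn⟩

end ReductionNumbers

theorem reductionNumber_le {R : Type*} [CommRing R] {I Q : Ideal R} (hQ : IsMinimalReduction Q I)
    {k : ℕ} (hk : I ^ (k + 1) = Q * I ^ k) : reductionNumber I ≤ k :=
  calc reductionNumber I ≤ relReductionNumber Q I := Nat.sInf_le ⟨Q, hQ, rfl⟩
    _ ≤ k := Nat.sInf_le hk

theorem proposition3p1_general {R : Type*} [CommRing R] [IsLocalRing R] [IsNoetherianRing R]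
    [Infinite (IsLocalRing.ResidueField R)] (hdim : 0 < ringKrullDim R) {I Q : Ideal R}
    (haci : IsAlmostCompleteIntersection I) (hQ : IsMinimalReduction Q I) {n : ℕ} (hn : 1 ≤ n)
    (hlen : Module.length R
      (↥(I ^ n) ⧸ Submodule.submoduleOf (Q * I ^ (n - 1)) (I ^ n)) = 1) :
    (reductionNumber I : ℤ) ≤ (n : ℤ) * (idealNu (IsLocalRing.maximalIdeal R) : ℤ) - 1 := by
  obtain ⟨hQI, ⟨d, hd, a, rfl⟩, k, hk⟩ := hQ
  obtain ⟨n, rfl⟩ := Nat.exists_eq_add_of_le' hn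
  obtain ⟨x, hx⟩ := haci.exists_eq_sup_span_singleton hQI hk
  obtain ⟨b, hb, r, hr, hbr⟩ := exists_pow_eq_mul_of_length_eq_one hdim hx hlen
  have hle : reductionNumber I ≤ r := reductionNumber_le ⟨hb, ⟨d, hd, b, rfl⟩, r, hbr⟩ hbr
  rw [le_sub_iff_add_le]
  exact_mod_cast (Nat.succ_le_succ hle).trans hr

theorem proposition3p1 {R : Type*} [CommRing R] [IsLocalRing R] [IsNoetherianRing R]
    [Infinite (IsLocalRing.ResidueField R)]
    (d : ℕ) (hd : 1 ≤ d) (hdim : ringKrullDim R = d)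
    (I Q : Ideal R) (hI : IsMPrimary I) (haci : IsAlmostCompleteIntersection I)
    (hQ : IsMinimalReduction Q I)
    (n : ℕ) (hn : 1 ≤ n)
    (hlen : Module.length R
      (↥(I ^ n) ⧸ Submodule.submoduleOf (Q * I ^ (n - 1)) (I ^ n)) = 1) :
    (reductionNumber I : ℤ) ≤ (n : ℤ) * (idealNu (IsLocalRing.maximalIdeal R) : ℤ) - 1 := by
  exact proposition3p1_general (by rw [hdim]; exact_mod_cast hd) haci hQ hn hlen
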